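/- Let $k > d \ge 3$ be integers and let $\Gamma = \langle s_1,\dots,s_d : s_1^k = \dots = s_d^k = e\rangle$ be the free product of $d$ copies of $\mathbb{Z}/k\mathbb{Z}$. Let \[ X = \Big\{ x \in (\mathbb{Z}/2\mathbb{Z})^\Gamma : \sum_{j=0}^{k-1} x_{g s_i^j} = 0 \text{ for all } g \in \Gamma,\ i = 1,\dots,d \Big\}, \] a compact group under pointwise addition and the topology of pointwise convergence, let $m_X$ be its Haar probability measure, and let $\Gamma$ act on $X$ by the shift $(T^g x)_h = x_{g^{-1}h}$, which preserves $m_X$. Then the system $(X, m_X, T)$ is not weakly contained in any Bernoulli shift $(K^\Gamma, \kappa^\Gamma, T)$ over $\Gamma$, where $(K,\kappa)$ is a standard probability space and $\Gamma$ acts on $K^\Gamma$ by the same formula. Here a measure-preserving action $S$ of $\Gamma$ on a probability space $(Y_1,\mu)$ is weakly contained in a measure-preserving action $R$ of $\Gamma$ on a probability space $(Y_2,\nu)$ if for all measurable $A_1,\dots,A_n \subseteq Y_1$, every finite $F \subseteq \Gamma$ and every $\varepsilon > 0$ there are measurable $B_1,\dots,B_n \subseteq Y_2$ such that $|\mu(S^\gamma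 A_i \cap A_j) - \nu(R^\gamma B_i \cap B_j)| < \varepsilon$ for all $\gamma \in F$ and all $1 \le i, j \le n$. -/

import Mathlib

open MeasureTheory

/-- A probability-measure-preserving action of a group `Γ` on a probability space `(X, μ)`: an
action of `Γ` by measurable, measure-preserving transformations. -/
structure PMPAction (Γ : Type*) [Group Γ] (X : Type*) [MeasurableSpace X] (μ : Measure X)
    [IsProbabilityMeasure μ] where
  /-- The transformation of `X` given by a group element. -/
  act : Γ → X → X
  act_one : ∀ x, act 1 x = x
  act_mul : ∀ g h x, act (g * h) x = act g (act h x)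
  measurePreserving : ∀ g, MeasurePreserving (act g) μ μ

/-- Weak containment of probability-measure-preserving actions (Kechris): the action `a` on
`(X, μ)` is weakly contained in the action `b` on `(Y, ν)` if for all measurable
`A₁, …, Aₙ ⊆ X`, all finite `F ⊆ Γ` and all `ε > 0` there are measurable `B₁, …, Bₙ ⊆ Y` with
`|μ(γ Aᵢ ∩ Aⱼ) - ν(γ Bᵢ ∩ Bⱼ)| < ε` for all `γ ∈ F` and all `i, j`. -/
def WeaklyContained {Γ : Type*} [Group Γ]
    {X : Type*} [MeasurableSpace X] {μ : Measure X} [IsProbabilityMeasure μ]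
    {Y : Type*} [MeasurableSpace Y] {ν : Measure Y} [IsProbabilityMeasure ν]
    (a : PMPAction Γ X μ) (b : PMPAction Γ Y ν) : Prop :=
  ∀ (n : ℕ) (A : Fin n → Set X), (∀ i, MeasurableSet (A i)) →
    ∀ (F : Finset Γ) (ε : ℝ), 0 < ε →
      ∃ B : Fin n → Set Y, (∀ i, MeasurableSet (B i)) ∧
        ∀ γ ∈ F, ∀ i j,
          |μ.real ((a.act γ '' A i) ∩ A j) - ν.real ((b.act γ '' B i) ∩ B j)| < ε

/-- The shift `(T^g x)(h) = x(g⁻¹ h)` on configurations `Γ → A`. -/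
def shift {Γ A : Type*} [Group Γ] (g : Γ) (x : Γ → A) : Γ → A := fun h => x (g⁻¹ * h)

/-- The Bernoulli shift over `Γ` with base space `(K, κ)`: the shift action on `Γ → K` with the
product measure of copies of `κ`. -/
noncomputable def bernoulliShift (Γ : Type*) [Group Γ] (K : Type*) [MeasurableSpace K]
    (κ : Measure K) [IsProbabilityMeasure κ] :
    PMPAction Γ (Γ → K) (Measure.infinitePi (fun _ : Γ => κ)) where
  act := shift
  act_one x := by
    funext h
    simp [shift]
  act_mul g h x := by
    funext l
    simp [shift, mul_assoc]
  measurePreserving g := by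
    refine ⟨measurable_pi_lambda _ fun h => measurable_pi_apply _, ?_⟩
    have key := Measure.infinitePi_map_piCongrLeft (fun _ : Γ => κ) (Equiv.mulLeft g)
    have hfun : (MeasurableEquiv.piCongrLeft (fun _ : Γ => K) (Equiv.mulLeft g) :
        (Γ → K) → (Γ → K)) = shift g := by
      funext x h
      obtain ⟨l, rfl⟩ := (Equiv.mulLeft g).surjective h
      rw [MeasurableEquiv.coe_piCongrLeft, Equiv.piCongrLeft_apply_apply]
      simp [shift]
    rw [hfun] at key
    exact key

/-- The group `Γ_{d,k}`: the free product of `d` copies of the cyclic group of order `k`. -/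
abbrev FreeProd (d k : ℕ) : Type := Monoid.CoprodI (fun _ : Fin d => Multiplicative (ZMod k))

/-- The standard generator `sᵢ` of `Γ_{d,k}`, which generates the `i`-th free factor. -/
def gen {d : ℕ} (k : ℕ) (i : Fin d) : FreeProd d k :=
  Monoid.CoprodI.of (M := fun _ : Fin d => Multiplicative (ZMod k)) (i := i)
    (Multiplicative.ofAdd 1)

/-- The parity check subshift: all `x : Γ_{d,k} → ℤ/2` with `∑_{j < k} x(g sᵢ^j) = 0` for all
`g` and `i`. -/
def parityCheck (d k : ℕ) : AddSubgroup (FreeProd d k → ZMod 2) where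
  carrier := {x | ∀ (g : FreeProd d k) (i : Fin d),
    ∑ j ∈ Finset.range k, x (g * gen k i ^ j) = 0}
  zero_mem' := by
    intro g i
    simp
  add_mem' := by
    intro x y hx hy g i
    simp [Finset.sum_add_distrib, hx g i, hy g i]
  neg_mem' := by
    intro x hx g i
    simp [hx g i]

instance instCountableFreeProd (d k : ℕ) : Countable (FreeProd d k) := by
  have : Countable (Multiplicative (ZMod k)) := by
    cases k with
    | zero => exact (inferInstance : Countable ℤ)
    | succ k => exact (inferInstance : Countable (Fin (k + 1)))
  have : Countable (FreeMonoid (Σ _ : Fin d, Multiplicative (ZMod k))) :=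
    (inferInstance : Countable (List (Σ _ : Fin d, Multiplicative (ZMod k))))
  exact Quotient.countable

instance instBorelSpaceZModTwo : BorelSpace (ZMod 2) :=
  ⟨borel_eq_top_of_discrete.symm⟩

instance instBorelSpaceParityCheck (d k : ℕ) : BorelSpace (parityCheck d k) :=
  Subtype.borelSpace _

theorem isClosed_parityCheck (d k : ℕ) :
    IsClosed (parityCheck d k : Set (FreeProd d k → ZMod 2)) := by
  have h : (parityCheck d k : Set (FreeProd d k → ZMod 2)) =
      ⋂ (g : FreeProd d k) (i : Fin d),
        {x | ∑ j ∈ Finset.range k, x (g * gen k i ^ j) = 0} := by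
    ext x
    simp [parityCheck]
  rw [h]
  exact isClosed_iInter fun g => isClosed_iInter fun i =>
    isClosed_eq (continuous_finsetSum _ fun j _ => continuous_apply _) continuous_const

instance instCompactSpaceParityCheck (d k : ℕ) : CompactSpace (parityCheck d k) :=
  isCompact_iff_compactSpace.mp (isClosed_parityCheck d k).isCompact

/-- The Haar probability measure `m_X` on the compact group `X`. -/
noncomputable def parityHaar (d k : ℕ) : Measure (parityCheck d k) :=
  Measure.addHaarMeasure ⊤

instance instIsProbabilityMeasureParityHaar (d k : ℕ) :
    IsProbabilityMeasure (parityHaar d k) :=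
  ⟨Measure.addHaarMeasure_self (K₀ := (⊤ : TopologicalSpace.PositiveCompacts _))⟩

instance instIsAddHaarMeasureParityHaar (d k : ℕ) : (parityHaar d k).IsAddHaarMeasure :=
  inferInstanceAs (Measure.addHaarMeasure _).IsAddHaarMeasure

theorem shift_mem_parityCheck {d k : ℕ} (g : FreeProd d k) {x : FreeProd d k → ZMod 2}
    (hx : x ∈ parityCheck d k) : shift g x ∈ parityCheck d k := by
  intro h i
  have := hx (g⁻¹ * h) i
  simpa [shift, mul_assoc] using this

/-- The system `(X, m_X, T)`: the shift action of `Γ_{d,k}` on the parity check subshift with its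
Haar probability measure. -/
noncomputable def paritySystem (d k : ℕ) :
    PMPAction (FreeProd d k) (parityCheck d k) (parityHaar d k) where
  act g x := ⟨shift g x.1, shift_mem_parityCheck g x.2⟩
  act_one x := by
    ext h
    simp [shift]
  act_mul g h x := by
    ext l
    simp [shift, mul_assoc]
  measurePreserving g := by
    let f : parityCheck d k →+ parityCheck d k :=
      { toFun := fun x => ⟨shift g x.1, shift_mem_parityCheck g x.2⟩
        map_zero' := rfl
        map_add' := fun _ _ => rfl }
    have hc : Continuous f := by
      refine Continuous.subtype_mk (f := fun x : parityCheck d k => shift g x.1) ?_ _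
      exact continuous_pi fun h => (continuous_apply (g⁻¹ * h)).comp continuous_subtype_val
    have hs : Function.Surjective f := fun y =>
      ⟨⟨shift g⁻¹ y.1, shift_mem_parityCheck g⁻¹ y.2⟩, by
        ext h
        change shift g (shift g⁻¹ y.1) h = y.1 h
        simp [shift]⟩
    exact f.measurePreserving hc hs rfl

/-!
The parity check system is separated from Bernoulli shifts by sparse almost-codewords: an entropy
inequality forbids them for finite-window factors of i.i.d. processes, but interpolation between two
independent almost-codewords produces them.

Suppose the parity check system were weakly contained in a Bernoulli shift. On `X` the number `N` of
ones on a coset `⟨sᵢ⟩` is even, which is a linear relation `N = 2 ∑ₘ 1[N ≥ 2m]` between indicator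
functions. The `L²` norm of a linear combination of indicators only involves measures of pairwise
intersections, so weak containment carries such relations over
(`WeaklyContained.exists_even_set`): there is a measurable `B ⊆ K^Γ` of measure close to `1/2` for
which the random set `{g : g⁻¹ω ∈ B}` meets most cosets of every `⟨sᵢ⟩` in an even number of
points. By approximation, `B` may be taken to depend on finitely many coordinates, each seen through
a map to a finite alphabet `Q` (`exists_finiteWindowSet_measureReal_symmDiff_lt`).

Let `ω'` equal `ω` with some coordinates resampled independently, with probability `t` each. The
symmetric difference of the random sets of `ω` and of `ω'` still has even intersections with
most cosets; its density is a polynomial in `t`, vanishes at `t = 0` and is `2p(1 - p)` at `t = 1`,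
where `p` is the measure of `B`. So it takes the very small value `δ = 2 ^ (-4dk)`
(`not_even_block_factor`).

Such a sparse random set `Z` does not exist. Let `h(p) = -p log p`. With `Cᵢ = Z ∩ ⟨sᵢ⟩`, the
entropy inequality (`entropy_inequality`) reads
`(d - 1) h(ℙ(e ∈ Z)) ≤ k⁻¹ ∑ᵢ ∑_{S ≠ ∅} h(ℙ(Cᵢ = S))`.
A nonempty even intersection has at least two points, so `ℙ(Cᵢ ≠ ∅)` is at most about `kδ / 2` and
the right hand side is about `(d / 2) δ log(1 / δ)`. For `d ≥ 3` this is less than the left hand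
side `(d - 1) δ log(1 / δ)` (`not_sparse_even_set`).

The entropy inequality is proved by revealing the coordinates `ω g` in random order, every
coordinate being revealed by time `s` with probability `s`. The information about `Cᵢ` gained from
one coordinate `j` is at least that gained about `1[v ∈ Z]`, for any `v ∈ ⟨sᵢ⟩`
(`entDrop_sum_le`, a consequence of the log-sum inequality). For `j = sᵢ^a u`, where `u` is a
reduced word that does not start with a power of `sᵢ`, take `v = sᵢ^a`; by invariance this is the
information that the coordinate `u` gives about `1[e ∈ Z]`. Every `u` fails to start with a
power of `sᵢ` for at least `d - 1` values of `i`, which yields the factor `d - 1`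
(`sum_sum_le_of_firstSyllable`).
-/

/-! ### Averaging over coordinates -/

section Resampling

variable {ι Q : Type*} [DecidableEq ι] [Fintype Q]

/-- The operator that averages a function of `ω : ι → Q` over the coordinate `j`, where letters of
the alphabet `Q` have weights `w`: the conditional expectation given all the other coordinates. -/
noncomputable def avg (w : Q → ℝ) (j : ι) : Module.End ℝ ((ι → Q) → ℝ) where
  toFun f ω := ∑ q, w q * f (Function.update ω j q)
  map_add' f g := by
    funext ω
    simp [mul_add, Finset.sum_add_distrib]
  map_smul' c f := by
    funext ω
    simp [Finset.mul_sum, mul_left_comm]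

theorem avg_apply (w : Q → ℝ) (j : ι) (f : (ι → Q) → ℝ) (ω : ι → Q) :
    avg w j f ω = ∑ q, w q * f (Function.update ω j q) := rfl

theorem avg_commute (w : Q → ℝ) (i j : ι) : Commute (avg w i) (avg w j) := by
  rcases eq_or_ne i j with rfl | hij
  · exact Commute.refl _
  · refine LinearMap.ext fun f => funext fun ω => ?_
    simp only [Module.End.mul_apply, avg_apply, Finset.mul_sum]
    rw [Finset.sum_comm]
    refine Finset.sum_congr rfl fun a _ => Finset.sum_congr rfl fun b _ => ?_
    rw [Function.update_comm hij]
    ring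

theorem pairwise_avg_commute (w : Q → ℝ) (s : Set ι) :
    s.Pairwise (Function.onFun Commute (avg w)) :=
  fun i _ j _ _ => avg_commute w i j

/-- The composition of the commuting operators `avg w j` over `j ∈ T`: the conditional expectation
given the coordinates outside `T`. The value is again a function of all of `ω`, constant in the
coordinates in `T`; an expectation is the value at an arbitrary point of `avgs w D f`, where `f`
depends on `D` only. -/
noncomputable def avgs (w : Q → ℝ) (T : Finset ι) : Module.End ℝ ((ι → Q) → ℝ) :=
  T.noncommProd (avg w) (pairwise_avg_commute w _)

@[simp]
theorem avgs_empty (w : Q → ℝ) (f : (ι → Q) → ℝ) : avgs w ∅ f = f := by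
  rw [avgs, Finset.noncommProd_empty, Module.End.one_apply]

theorem avgs_insert (w : Q → ℝ) {T : Finset ι} {j : ι} (hj : j ∉ T) (f : (ι → Q) → ℝ) :
    avgs w (insert j T) f = avg w j (avgs w T f) := by
  rw [avgs, Finset.noncommProd_insert_of_notMem _ _ _ _ hj]
  rfl

theorem avgs_insert' (w : Q → ℝ) {T : Finset ι} {j : ι} (hj : j ∉ T) (f : (ι → Q) → ℝ) :
    avgs w (insert j T) f = avgs w T (avg w j f) := by
  rw [avgs, Finset.noncommProd_insert_of_notMem' _ _ _ _ hj]
  rfl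

theorem avg_mono {w : Q → ℝ} (hw : ∀ q, 0 ≤ w q) (j : ι) {f g : (ι → Q) → ℝ} (h : f ≤ g) :
    avg w j f ≤ avg w j g := fun _ =>
  Finset.sum_le_sum fun q _ => mul_le_mul_of_nonneg_left (h _) (hw q)

theorem avgs_mono {w : Q → ℝ} (hw : ∀ q, 0 ≤ w q) (T : Finset ι) {f g : (ι → Q) → ℝ}
    (h : f ≤ g) : avgs w T f ≤ avgs w T g := by
  induction T using Finset.induction_on with
  | empty => simpa using h
  | insert j T hj ih =>
    rw [avgs_insert w hj, avgs_insert w hj]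
    exact avg_mono hw j ih

theorem avgs_nonneg {w : Q → ℝ} (hw : ∀ q, 0 ≤ w q) (T : Finset ι) {f : (ι → Q) → ℝ}
    (h : 0 ≤ f) : 0 ≤ avgs w T f := by
  simpa using avgs_mono hw T h

theorem avg_eq_self {w : Q → ℝ} (hw : ∑ q, w q = 1) {f : (ι → Q) → ℝ} {s : Set ι}
    (hf : DependsOn f s) {j : ι} (hj : j ∉ s) : avg w j f = f := by
  funext ω
  have h : ∀ q, f (Function.update ω j q) = f ω := fun q =>
    hf fun i hi => Function.update_of_ne (ne_of_mem_of_not_mem hi hj) _ _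
  simp [avg_apply, h, ← Finset.sum_mul, hw]

theorem DependsOn.avg {w : Q → ℝ} {f : (ι → Q) → ℝ} {s : Set ι} (hf : DependsOn f s) (j : ι) :
    DependsOn (avg w j f) (s \ {j}) := by
  intro ω ω' h
  refine Finset.sum_congr rfl fun q _ => ?_
  congr 1
  refine hf fun i hi => ?_
  rcases eq_or_ne i j with rfl | hij
  · simp
  · rw [Function.update_of_ne hij, Function.update_of_ne hij]
    exact h i ⟨hi, hij⟩

theorem DependsOn.avgs {w : Q → ℝ} {f : (ι → Q) → ℝ} {s : Set ι} (hf : DependsOn f s)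
    (T : Finset ι) : DependsOn (avgs w T f) (s \ T) := by
  induction T using Finset.induction_on with
  | empty => simpa using hf
  | insert j T hj ih =>
    rw [avgs_insert w hj]
    refine (ih.avg j).mono ?_
    intro i
    simp only [Finset.coe_insert, Set.mem_sdiff, Set.mem_insert_iff, Set.mem_singleton_iff]
    tauto

theorem avgs_const {w : Q → ℝ} (hw : ∑ q, w q = 1) (T : Finset ι) (c : ℝ) :
    avgs w T (fun _ => c) = fun _ => c := by
  induction T using Finset.induction_on with
  | empty => simp
  | insert j T hj ih => rw [avgs_insert w hj, ih, avg_eq_self hw (dependsOn_const c) (by simp)]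

theorem avgs_union_of_disjoint {w : Q → ℝ} (hw : ∑ q, w q = 1) {f : (ι → Q) → ℝ} {s : Set ι}
    (hf : DependsOn f s) (T : Finset ι) {U : Finset ι} (hU : ∀ j ∈ U, j ∉ s) :
    avgs w (T ∪ U) f = avgs w T f := by
  induction U using Finset.induction_on with
  | empty => simp
  | insert j U hj ih =>
    have ih' := ih fun i hi => hU i (Finset.mem_insert_of_mem hi)
    rw [Finset.union_insert]
    by_cases h : j ∈ T ∪ U
    · rwa [Finset.insert_eq_of_mem h]
    · rw [avgs_insert' w h, avg_eq_self hw hf (hU j (Finset.mem_insert_self _ _)), ih']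

/-- Averaging over coordinates on which `f` does not depend has no effect. -/
theorem avgs_eq_of_inter {w : Q → ℝ} (hw : ∑ q, w q = 1) {f : (ι → Q) → ℝ} {D : Set ι}
    (hf : DependsOn f D) {T T' : Finset ι} (h : ∀ j ∈ D, j ∈ T ↔ j ∈ T') :
    avgs w T f = avgs w T' f := by
  rw [← avgs_union_of_disjoint hw hf T (U := T' \ T),
    ← avgs_union_of_disjoint hw hf T' (U := T \ T')]
  · congr 1
    congr 1
    ext i
    simp only [Finset.mem_union, Finset.mem_sdiff]
    tauto
  · intro j hj hD
    have := h j hD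
    simp only [Finset.mem_sdiff] at hj
    tauto
  · intro j hj hD
    have := h j hD
    simp only [Finset.mem_sdiff] at hj
    tauto

theorem avgs_apply_eq {w : Q → ℝ} {f : (ι → Q) → ℝ} {D : Finset ι}
    (hf : DependsOn f D) (ω ω' : ι → Q) : avgs w D f ω = avgs w D f ω' :=
  hf.avgs D fun _ hi => absurd hi.1 hi.2

theorem avg_avg {w : Q → ℝ} (hw : ∑ q, w q = 1) (j : ι) (f : (ι → Q) → ℝ) :
    avg w j (avg w j f) = avg w j f :=
  avg_eq_self hw ((dependsOn_univ f).avg j) (by simp)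

theorem avgs_avg {w : Q → ℝ} (hw : ∑ q, w q = 1) {E : Finset ι} {j : ι} (hj : j ∈ E)
    (f : (ι → Q) → ℝ) : avgs w E (avg w j f) = avgs w E f := by
  rw [← Finset.insert_erase hj, avgs_insert' w (Finset.notMem_erase j E),
    avgs_insert' w (Finset.notMem_erase j E), avg_avg hw]

theorem avg_comp_equiv (w : Q → ℝ) (e : ι ≃ ι) (j : ι) (f : (ι → Q) → ℝ) :
    avg w (e j) (fun ω => f (ω ∘ e)) = fun ω => avg w j f (ω ∘ e) := by
  funext ω
  refine Finset.sum_congr rfl fun q _ => ?_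
  congr 1
  refine congrArg f (funext fun i => ?_)
  simp [Function.update_apply]

theorem avgs_comp_equiv (w : Q → ℝ) (e : ι ≃ ι) (T : Finset ι) (f : (ι → Q) → ℝ) :
    avgs w (T.map e.toEmbedding) (fun ω => f (ω ∘ e)) = fun ω => avgs w T f (ω ∘ e) := by
  induction T using Finset.induction_on with
  | empty => simp
  | insert j T hj ih =>
    have h : e j ∉ T.map e.toEmbedding := by simpa using hj
    rw [Finset.map_insert, Equiv.coe_toEmbedding, avgs_insert w h, avgs_insert w hj, ih,
      avg_comp_equiv]

theorem avg_comp_map {R : Type*} [Fintype R] {w : Q → ℝ} {v : R → ℝ} {r : R → Q}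
    (hr : ∀ g : Q → ℝ, ∑ x, v x * g (r x) = ∑ q, w q * g q) (j : ι) (f : (ι → Q) → ℝ) :
    avg v j (fun ω => f (r ∘ ω)) = fun ω => avg w j f (r ∘ ω) := by
  funext ω
  simp only [avg_apply, Function.comp_update]
  exact hr fun q => f (Function.update (r ∘ ω) j q)

theorem avgs_comp_map {R : Type*} [Fintype R] {w : Q → ℝ} {v : R → ℝ} {r : R → Q}
    (hr : ∀ g : Q → ℝ, ∑ x, v x * g (r x) = ∑ q, w q * g q) (T : Finset ι)
    (f : (ι → Q) → ℝ) :
    avgs v T (fun ω => f (r ∘ ω)) = fun ω => avgs w T f (r ∘ ω) := by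
  induction T using Finset.induction_on with
  | empty => simp
  | insert j T hj ih => rw [avgs_insert v hj, avgs_insert w hj, ih, avg_comp_map hr]

/-- If `r` and `r'` are independent with law `w` under the weights `v`, then so are `r ∘ ω` and `r'
∘ ω`. -/
theorem avgs_mul_of_indep {R : Type*} [Fintype R] {w : Q → ℝ} {v : R → ℝ} {r r' : R → Q}
    (hr : ∀ g g' : Q → ℝ, ∑ x, v x * (g (r x) * g' (r' x)) =
      (∑ q, w q * g q) * ∑ q, w q * g' q) (T : Finset ι) (f f' : (ι → Q) → ℝ) :
    avgs v T (fun ω => f (r ∘ ω) * f' (r' ∘ ω)) =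
      fun ω => avgs w T f (r ∘ ω) * avgs w T f' (r' ∘ ω) := by
  induction T using Finset.induction_on with
  | empty => simp
  | insert j T hj ih =>
    rw [avgs_insert v hj, avgs_insert w hj, avgs_insert w hj, ih]
    funext ω
    simp only [avg_apply, Function.comp_update]
    exact hr (fun q => avgs w T f (Function.update (r ∘ ω) j q))
      fun q => avgs w T f' (Function.update (r' ∘ ω) j q)

theorem continuous_avgs {X : Type*} [TopologicalSpace X] {w : X → Q → ℝ}
    (hw : ∀ q, Continuous fun t => w t q) (T : Finset ι) (f : (ι → Q) → ℝ) (ω : ι → Q) :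
    Continuous fun t => avgs (w t) T f ω := by
  induction T using Finset.induction_on generalizing ω with
  | empty => simpa using continuous_const
  | insert j T hj ih =>
    simp only [avgs_insert _ hj, avg_apply]
    exact continuous_finsetSum _ fun q _ => (hw q).mul (ih _)

end Resampling

/-! ### Entropy inequalities for real numbers -/

section RealInequalities

theorem Real.sub_le_mul_log_sub_mul_log {x y : ℝ} (hx : 0 ≤ x) (hy : 0 ≤ y)
    (hxy : y = 0 → x = 0) : x - y ≤ x * Real.log x - x * Real.log y := by
  rcases hx.eq_or_lt with rfl | hx
  · simpa using hy
  · have hy : 0 < y := hy.lt_of_ne fun h => hx.ne' (hxy h.symm)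
    have h := mul_le_mul_of_nonneg_left (Real.log_le_sub_one_of_pos (div_pos hy hx)) hx.le
    rw [Real.log_div hy.ne' hx.ne', mul_sub, mul_sub, mul_div_cancel₀ _ hx.ne'] at h
    linarith

/-- The log-sum inequality, with the convention `0 log 0 = 0` built into `Real.log`. -/
theorem log_sum_inequality {Q : Type*} [Fintype Q] {w : Q → ℝ} (hw : ∀ q, 0 ≤ w q) {a b : Q → ℝ}
    (ha : ∀ q, 0 ≤ a q) (hab : ∀ q, a q ≤ b q) :
    (∑ q, w q * a q) * Real.log (∑ q, w q * a q) - (∑ q, w q * a q) * Real.log (∑ q, w q * b q) ≤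
      ∑ q, w q * (a q * Real.log (a q) - a q * Real.log (b q)) := by
  set α := ∑ q, w q * a q with hα
  set β := ∑ q, w q * b q with hβ
  have hα0 : 0 ≤ α := Finset.sum_nonneg fun q _ => mul_nonneg (hw q) (ha q)
  have hαβ : α ≤ β := Finset.sum_le_sum fun q _ => mul_le_mul_of_nonneg_left (hab q) (hw q)
  rcases hα0.eq_or_lt with h0 | h0
  · have h : ∀ q, w q * a q = 0 := fun q =>
      (Finset.sum_eq_zero_iff_of_nonneg fun q _ => mul_nonneg (hw q) (ha q)).1 (hα ▸ h0.symm) q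
        (Finset.mem_univ q)
    have : ∀ q, w q * (a q * Real.log (a q) - a q * Real.log (b q)) = 0 := fun q => by
      rw [mul_sub, ← mul_assoc, ← mul_assoc, h q]
      simp
    simp [this, ← h0]
  · have hβ0 : 0 < β := h0.trans_le hαβ
    have hr : 0 < α / β := div_pos h0 hβ0
    -- The tangent plane inequality at `(α, β)` for the perspective function `x log (x / y)`.
    have key : ∀ q, w q * (a q - b q * (α / β)) + w q * a q * (Real.log α - Real.log β) ≤
        w q * (a q * Real.log (a q) - a q * Real.log (b q)) := by
      intro q
      rw [mul_assoc, ← mul_add]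
      refine mul_le_mul_of_nonneg_left ?_ (hw q)
      have hb : 0 ≤ b q := (ha q).trans (hab q)
      rcases hb.eq_or_lt with hb | hb
      · have : a q = 0 := le_antisymm (hb ▸ hab q) (ha q)
        simp [this, ← hb]
      · have := Real.sub_le_mul_log_sub_mul_log (ha q) (mul_pos hb hr).le
          fun h => absurd h (mul_pos hb hr).ne'
        rw [Real.log_mul hb.ne' hr.ne', Real.log_div h0.ne' hβ0.ne'] at this
        linarith
    refine le_trans (le_of_eq ?_) (Finset.sum_le_sum fun q _ => key q)
    have h1 : ∑ q, w q * (a q - b q * (α / β)) = 0 := by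
      simp only [mul_sub, Finset.sum_sub_distrib, ← mul_assoc, ← Finset.sum_mul]
      rw [← hα, ← hβ, mul_div_cancel₀ _ hβ0.ne', sub_self]
    rw [Finset.sum_add_distrib, h1, ← Finset.sum_mul, ← hα]
    ring

theorem negMulLog_jensen {Q : Type*} [Fintype Q] {w : Q → ℝ} (hw : w ∈ stdSimplex ℝ Q)
    {a : Q → ℝ} (ha : ∀ q, 0 ≤ a q) :
    ∑ q, w q * Real.negMulLog (a q) ≤ Real.negMulLog (∑ q, w q * a q) := by
  simpa using Real.concaveOn_negMulLog.le_map_sum (t := Finset.univ) (fun q _ => hw.1 q) hw.2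
    fun q _ => ha q

/-- The gap in Jensen's inequality for `h(x) = -x log x` is larger for a finer partition: merging
the family `a s`, `s ∈ T`, into its sum and dropping the members outside `T` decreases the total
gap. -/
theorem jensen_gap_sum_le {Q S : Type*} [Fintype Q] {w : Q → ℝ} (hw : w ∈ stdSimplex ℝ Q)
    {T U : Finset S} (hTU : T ⊆ U) {a : S → Q → ℝ} (ha : ∀ s q, 0 ≤ a s q) :
    Real.negMulLog (∑ q, w q * ∑ s ∈ T, a s q) - ∑ q, w q * Real.negMulLog (∑ s ∈ T, a s q) ≤
      ∑ s ∈ U, (Real.negMulLog (∑ q, w q * a s q) - ∑ q, w q * Real.negMulLog (a s q)) := by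
  refine le_trans ?_ (Finset.sum_le_sum_of_subset_of_nonneg hTU fun s _ _ =>
    sub_nonneg.2 (negMulLog_jensen hw (ha s)))
  have h1 : ∀ s ∈ T, _ := fun s hs => log_sum_inequality hw.1 (ha s)
    fun q => Finset.single_le_sum (fun s _ => ha s q) hs
  have h2 := Finset.sum_le_sum h1
  have h3 : ∑ q, w q * ∑ s ∈ T, a s q = ∑ s ∈ T, ∑ q, w q * a s q := by
    simp only [Finset.mul_sum]
    exact Finset.sum_comm
  have h4 : ∑ s ∈ T, ∑ q, w q * (a s q * Real.log (∑ s ∈ T, a s q)) =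
      ∑ q, w q * ((∑ s ∈ T, a s q) * Real.log (∑ s ∈ T, a s q)) := by
    rw [Finset.sum_comm]
    simp only [Finset.mul_sum, Finset.sum_mul]
  simp only [mul_sub, Finset.sum_sub_distrib, ← Finset.sum_mul] at h2
  rw [h4, h3] at h2
  simp only [Real.negMulLog, neg_mul, mul_neg, Finset.sum_neg_distrib, Finset.sum_sub_distrib]
  rw [h3]
  linarith

end RealInequalities

/-! ### Conditional entropy given a set of coordinates -/

section CondEnt

variable {ι Q : Type*} [DecidableEq ι] [Fintype Q]

/-- The expectation of `h(𝔼[f | ω_A])`, where `h(x) = -x log x`, for a function `f` depending on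
the coordinates in `E`. If `f` is the indicator function of an event, this is the contribution of
that event to the conditional entropy, given `ω_A`, of a partition containing it. Only `A ∩ E`
matters, and the point `ω` is immaterial (`condEnt_apply_eq`). -/
noncomputable def condEnt (w : Q → ℝ) (E : Finset ι) (f : (ι → Q) → ℝ) (ω : ι → Q)
    (A : Finset ι) : ℝ :=
  avgs w E (fun ω => Real.negMulLog (avgs w (E \ A) f ω)) ω

/-- The decrease of `condEnt` when the coordinate `j` is revealed in addition to those in `A`. -/
noncomputable def entDrop (w : Q → ℝ) (E : Finset ι) (f : (ι → Q) → ℝ) (ω : ι → Q) (j : ι)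
    (A : Finset ι) : ℝ :=
  condEnt w E f ω A - condEnt w E f ω (insert j A)

theorem dependsOn_condEnt_integrand {w : Q → ℝ} {E : Finset ι} {f : (ι → Q) → ℝ}
    (hf : DependsOn f E) (A : Finset ι) :
    DependsOn (fun ω => Real.negMulLog (avgs w (E \ A) f ω)) E := fun _ _ h =>
  congrArg Real.negMulLog ((hf.avgs _).mono Set.sdiff_subset h)

theorem condEnt_apply_eq {w : Q → ℝ} {E : Finset ι} {f : (ι → Q) → ℝ}
    (hf : DependsOn f E) (A : Finset ι) (ω ω' : ι → Q) :
    condEnt w E f ω A = condEnt w E f ω' A :=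
  avgs_apply_eq (dependsOn_condEnt_integrand hf A) ω ω'

theorem condEnt_empty {w : Q → ℝ} (hw : ∑ q, w q = 1) {E : Finset ι} {f : (ι → Q) → ℝ}
    (hf : DependsOn f E) (ω : ι → Q) : condEnt w E f ω ∅ = Real.negMulLog (avgs w E f ω) := by
  have h : (fun ω' => Real.negMulLog (avgs w (E \ ∅) f ω')) =
      fun _ => Real.negMulLog (avgs w E f ω) := by
    funext ω'
    rw [Finset.sdiff_empty, avgs_apply_eq hf ω' ω]
  rw [condEnt, h, avgs_const hw]

theorem condEnt_self {w : Q → ℝ} (hw : ∑ q, w q = 1) {E : Finset ι} {f : (ι → Q) → ℝ}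
    (hf : ∀ ω, f ω = 0 ∨ f ω = 1) (ω : ι → Q) : condEnt w E f ω E = 0 := by
  have h : (fun ω' => Real.negMulLog (avgs w (E \ E) f ω')) = fun _ => 0 := by
    funext ω'
    rw [Finset.sdiff_self, avgs_empty]
    rcases hf ω' with h | h <;> simp [h]
  rw [condEnt, h, avgs_const hw]

theorem condEnt_of_subset {w : Q → ℝ} (hw : ∑ q, w q = 1) {D E : Finset ι} {f : (ι → Q) → ℝ}
    (hf : DependsOn f D) (hDE : D ⊆ E) (ω : ι → Q) {A A' : Finset ι}
    (hA : ∀ j ∈ D, j ∈ A ↔ j ∈ A') : condEnt w E f ω A = condEnt w D f ω A' := by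
  have h1 : avgs w (E \ A) f = avgs w (D \ A') f := avgs_eq_of_inter hw hf fun j hj => by
    have := hA j hj
    have hj' := hDE hj
    simp only [Finset.mem_coe] at hj
    simp [hj, hj', this]
  rw [condEnt, condEnt, h1, avgs_eq_of_inter hw (dependsOn_condEnt_integrand hf A')]
  intro j hj
  exact iff_of_true (hDE hj) hj

theorem condEnt_map (w : Q → ℝ) (D : Finset ι) (f : (ι → Q) → ℝ) (e : ι ≃ ι) (ω : ι → Q)
    (A : Finset ι) :
    condEnt w (D.map e.toEmbedding) (fun ω => f (ω ∘ e)) ω (A.map e.toEmbedding) =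
      condEnt w D f (ω ∘ e) A := by
  have h : D.map e.toEmbedding \ A.map e.toEmbedding = (D \ A).map e.toEmbedding := by
    ext i
    simp
  rw [condEnt, condEnt, h, avgs_comp_equiv,
    avgs_comp_equiv w e D fun ω => Real.negMulLog (avgs w (D \ A) f ω)]

theorem entDrop_eq {w : Q → ℝ} (hw : ∑ q, w q = 1) {E : Finset ι} (f : (ι → Q) → ℝ) (ω : ι → Q)
    {j : ι} (hj : j ∈ E) {A : Finset ι} (hjA : j ∉ A) :
    entDrop w E f ω j A = avgs w E (fun ω =>
      Real.negMulLog (avg w j (avgs w (E \ insert j A) f) ω) -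
        avg w j (fun ω => Real.negMulLog (avgs w (E \ insert j A) f ω)) ω) ω := by
  have h1 : E \ A = insert j (E \ insert j A) := by
    ext i
    simp only [Finset.mem_sdiff, Finset.mem_insert]
    by_cases h : i = j
    · subst h
      simp [hj, hjA]
    · simp [h]
  have h2 : j ∉ E \ insert j A := by simp
  rw [entDrop, condEnt, condEnt, h1, avgs_insert w h2, ← avgs_avg hw hj
    (fun ω => Real.negMulLog (avgs w (E \ insert j A) f ω)), ← Pi.sub_apply, ← map_sub]
  rfl

theorem entDrop_nonneg {w : Q → ℝ} (hw : w ∈ stdSimplex ℝ Q) {E : Finset ι} {f : (ι → Q) → ℝ}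
    (hf : 0 ≤ f) (ω : ι → Q) {j : ι} (hj : j ∈ E) {A : Finset ι} (hjA : j ∉ A) :
    0 ≤ entDrop w E f ω j A := by
  rw [entDrop_eq hw.2 f ω hj hjA]
  exact avgs_nonneg hw.1 E (fun ω => sub_nonneg.2 (negMulLog_jensen hw
    fun q => avgs_nonneg hw.1 _ hf _)) ω

/-- A coordinate gives more information about a finer partition: the entropy drop of an event that
is a union of atoms `s ∈ T` is at most the total drop of any family of atoms `U ⊇ T`. -/
theorem entDrop_sum_le {S : Type*} {w : Q → ℝ} (hw : w ∈ stdSimplex ℝ Q) {E : Finset ι}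
    {T U : Finset S} (hTU : T ⊆ U) {f : S → (ι → Q) → ℝ} (hf : ∀ s, 0 ≤ f s) (ω : ι → Q) {j : ι}
    (hj : j ∈ E) {A : Finset ι} (hjA : j ∉ A) :
    entDrop w E (∑ s ∈ T, f s) ω j A ≤ ∑ s ∈ U, entDrop w E (f s) ω j A := by
  simp only [entDrop_eq hw.2 _ ω hj hjA]
  rw [← Finset.sum_apply, ← map_sum]
  refine avgs_mono hw.1 E (fun ω => ?_) ω
  simp only [map_sum, Finset.sum_apply, avg_apply]
  have := jensen_gap_sum_le hw hTU
    (a := fun s q => avgs w (E \ insert j A) (f s) (Function.update ω j q))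
    fun s q => avgs_nonneg hw.1 _ (hf s) _
  convert this using 2

end CondEnt

/-! ### Expectations over random sets of coordinates -/

section Thinning

variable {ι : Type*} [DecidableEq ι]

/-- The expectation of `R A`, where `A ⊆ E` is random and contains each element of `E`
independently with probability `s`. -/
noncomputable def thin (s : ℝ) (E : Finset ι) (R : Finset ι → ℝ) : ℝ :=
  ∑ A ∈ E.powerset, s ^ A.card * (1 - s) ^ (E \ A).card * R A

theorem thin_insert (s : ℝ) {E : Finset ι} {j : ι} (hj : j ∉ E) (R : Finset ι → ℝ) :
    thin s (insert j E) R =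
      (1 - s) * thin s E R + s * thin s E (fun A => R (insert j A)) := by
  rw [thin, Finset.sum_powerset_insert hj, thin, thin, Finset.mul_sum, Finset.mul_sum]
  congr 1
  · refine Finset.sum_congr rfl fun A hA => ?_
    have hjA : j ∉ A := fun h => hj (Finset.mem_powerset.1 hA h)
    rw [Finset.insert_sdiff_of_notMem _ hjA, Finset.card_insert_of_notMem (by simp [hj])]
    ring
  · refine Finset.sum_congr rfl fun A hA => ?_
    have hjA : j ∉ A := fun h => hj (Finset.mem_powerset.1 hA h)
    have h : insert j E \ insert j A = E \ A := by
      ext i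
      simp only [Finset.mem_sdiff, Finset.mem_insert]
      by_cases h : i = j
      · subst h
        simp [hj]
      · simp [h]
    rw [h, Finset.card_insert_of_notMem hjA]
    ring

@[simp]
theorem thin_empty (s : ℝ) (R : Finset ι → ℝ) : thin s ∅ R = R ∅ := by
  simp [thin]

theorem thin_zero (E : Finset ι) (R : Finset ι → ℝ) : thin 0 E R = R ∅ := by
  induction E using Finset.induction_on with
  | empty => simp
  | insert j E hj ih => simp [thin_insert 0 hj, ih]

theorem thin_one (E : Finset ι) (R : Finset ι → ℝ) : thin 1 E R = R E := by
  induction E using Finset.induction_on generalizing R with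
  | empty => simp
  | insert j E hj ih => simp [thin_insert 1 hj, ih]

theorem thin_sub (s : ℝ) (E : Finset ι) (R R' : Finset ι → ℝ) :
    thin s E (fun A => R A - R' A) = thin s E R - thin s E R' := by
  simp [thin, mul_sub, Finset.sum_sub_distrib]

theorem thin_sum {S : Type*} (s : ℝ) (E : Finset ι) (U : Finset S) (R : S → Finset ι → ℝ) :
    thin s E (fun A => ∑ x ∈ U, R x A) = ∑ x ∈ U, thin s E (R x) := by
  simp only [thin, Finset.mul_sum]
  exact Finset.sum_comm

theorem thin_mono {s : ℝ} (h0 : 0 ≤ s) (h1 : s ≤ 1) {E : Finset ι} {R R' : Finset ι → ℝ}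
    (h : ∀ A ⊆ E, R A ≤ R' A) : thin s E R ≤ thin s E R' :=
  Finset.sum_le_sum fun A hA => mul_le_mul_of_nonneg_left (h A (Finset.mem_powerset.1 hA))
    (mul_nonneg (pow_nonneg h0 _) (pow_nonneg (sub_nonneg.2 h1) _))

theorem thin_nonneg {s : ℝ} (h0 : 0 ≤ s) (h1 : s ≤ 1) {E : Finset ι} {R : Finset ι → ℝ}
    (h : ∀ A ⊆ E, 0 ≤ R A) : 0 ≤ thin s E R := by
  simpa [thin] using thin_mono h0 h1 (R := fun _ => 0) h

theorem thin_congr (s : ℝ) {E : Finset ι} {R R' : Finset ι → ℝ}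
    (h : ∀ A ⊆ E, R A = R' A) : thin s E R = thin s E R' :=
  Finset.sum_congr rfl fun A hA => by rw [h A (Finset.mem_powerset.1 hA)]

/-- Elements that do not affect `R` can be dropped. -/
theorem thin_union_of_dummy (s : ℝ) (D U : Finset ι) {R : Finset ι → ℝ}
    (hR : ∀ A, ∀ j ∈ U, j ∉ D → R (insert j A) = R A) : thin s (D ∪ U) R = thin s D R := by
  induction U using Finset.induction_on with
  | empty => simp
  | insert j U hj ih =>
    have ih' := ih fun A i hi => hR A i (Finset.mem_insert_of_mem hi)
    rw [Finset.union_insert]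
    by_cases h : j ∈ D ∪ U
    · rwa [Finset.insert_eq_of_mem h]
    · have hjD : j ∉ D := fun h' => h (Finset.mem_union_left _ h')
      rw [thin_insert s h, thin_congr s fun A _ => hR A j (Finset.mem_insert_self _ _) hjD, ih']
      ring

theorem thin_map (s : ℝ) (E : Finset ι) (e : ι ≃ ι) (R : Finset ι → ℝ) :
    thin s (E.map e.toEmbedding) R = thin s E (fun A => R (A.map e.toEmbedding)) := by
  induction E using Finset.induction_on generalizing R with
  | empty => simp
  | insert j E hj ih =>
    have h : e j ∉ E.map e.toEmbedding := by simpa using hj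
    rw [Finset.map_insert, Equiv.coe_toEmbedding, thin_insert s h, thin_insert s hj, ih, ih]
    simp [Finset.map_insert]

/-- Russo's formula: the derivative of the expectation in `s` is the sum over `j` of the expected
influences of `j`. -/
theorem hasDerivAt_thin (s : ℝ) (E : Finset ι) (R : Finset ι → ℝ) :
    HasDerivAt (fun s => thin s E R)
      (∑ j ∈ E, thin s (E.erase j) fun A => R (insert j A) - R A) s := by
  induction E using Finset.induction_on generalizing R with
  | empty => simpa using hasDerivAt_const s (R ∅)
  | insert j E hj ih =>
    simp only [thin_insert _ hj]
    have h1 := ((hasDerivAt_id s).const_sub 1).mul (ih R)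
    have h2 := (hasDerivAt_id s).mul (ih fun A => R (insert j A))
    refine (h1.add h2).congr_deriv ?_
    rw [Finset.sum_insert hj, Finset.erase_insert hj, thin_sub]
    have h3 : ∀ i ∈ E, (thin s ((insert j E).erase i) fun A => R (insert i A) - R A) =
        (1 - s) * (thin s (E.erase i) fun A => R (insert i A) - R A) +
        s * thin s (E.erase i) fun A => R (insert j (insert i A)) - R (insert j A) := by
      intro i hi
      have hij : j ≠ i := fun h => hj (h ▸ hi)
      have : j ∉ E.erase i := fun h => hj (Finset.mem_of_mem_erase h)
      rw [Finset.erase_insert_of_ne hij, thin_insert s this]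
      simp only [Finset.insert_comm i j]
    rw [Finset.sum_congr rfl h3, Finset.sum_add_distrib, ← Finset.mul_sum, ← Finset.mul_sum]
    simp only [id]
    ring

end Thinning

/-! ### The entropy inequality over the free product -/

section FreeProduct

/-- Invariance of the information gained from one coordinate: the coordinate `e u` gives as much
about the translate of `f` by `e`, inside the larger window `E`, as `u` gives about `f`. -/
theorem thin_entDrop_map {ι Q : Type*} [DecidableEq ι] [Fintype Q] {w : Q → ℝ}
    (hw : ∑ q, w q = 1) {D E : Finset ι} {f : (ι → Q) → ℝ} (hf : DependsOn f D) (e : ι ≃ ι)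
    (hE : D.map e.toEmbedding ⊆ E) {u : ι} (hu : u ∈ D) (s : ℝ) (ω : ι → Q) :
    thin s (E.erase (e u)) (entDrop w E (fun ω => f (ω ∘ e)) ω (e u)) =
      thin s (D.erase u) (entDrop w D f ω u) := by
  set D' := D.map e.toEmbedding with hD'
  have hf' : DependsOn (fun ω : ι → Q => f (ω ∘ e)) D' := fun ω ω' h => hf fun i hi =>
    h (e i) (by simpa [hD'] using hi)
  have h1 : entDrop w E (fun ω => f (ω ∘ e)) ω (e u) =
      entDrop w D' (fun ω => f (ω ∘ e)) ω (e u) := by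
    funext A
    rw [entDrop, entDrop, condEnt_of_subset hw hf' hE ω fun _ _ => Iff.rfl,
      condEnt_of_subset hw hf' hE ω fun _ _ => Iff.rfl]
  have h2 : E.erase (e u) = D'.erase (e u) ∪ (E \ D') := by
    have hu' : e u ∈ D' := by simpa [hD'] using hu
    ext i
    simp only [Finset.mem_union, Finset.mem_erase, Finset.mem_sdiff]
    by_cases h : i ∈ D'
    · simp [h, hE h]
    · have : i ≠ e u := fun h' => h (h' ▸ hu')
      simp [h, this]
  have h3 : D'.erase (e u) = (D.erase u).map e.toEmbedding := by
    rw [Finset.map_erase]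
    rfl
  rw [h1, h2, thin_union_of_dummy, h3, thin_map]
  · refine thin_congr s fun A _ => ?_
    have h4 : insert (e u) (A.map e.toEmbedding) = (insert u A).map e.toEmbedding := by
      rw [Finset.map_insert]
      rfl
    rw [entDrop, entDrop, h4, condEnt_map, condEnt_map, condEnt_apply_eq hf A _ ω,
      condEnt_apply_eq hf (insert u A) _ ω]
  · intro A j hj _
    have hjD : j ∉ D' := (Finset.mem_sdiff.1 hj).2
    rw [entDrop, entDrop]
    congr 1 <;>
    · refine condEnt_of_subset hw hf' subset_rfl ω fun i hi => ?_
      have : i ≠ j := fun h => hjD (h ▸ hi)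
      simp [this]

variable {d k : ℕ}

theorem gen_pow (i : Fin d) (a : ℕ) :
    gen k i ^ a = Monoid.CoprodI.of (M := fun _ : Fin d => Multiplicative (ZMod k)) (i := i)
      (Multiplicative.ofAdd (a : ZMod k)) := by
  rw [gen, ← map_pow, ← ofAdd_nsmul, nsmul_one]

/-- The index of the free factor containing the first letter of the reduced word of `u`, and `none`
for `u = 1`. -/
noncomputable def firstSyllable (u : FreeProd d k) : Option (Fin d) :=
  (Monoid.CoprodI.Word.equiv u).fstIdx

/-- Uniqueness of the decomposition `sᵢ^a u`, where `u` does not start with a power of `sᵢ`. -/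
theorem gen_pow_mul_inj {i : Fin d} {a b : Fin k} {u v : FreeProd d k}
    (hu : firstSyllable u ≠ some i) (hv : firstSyllable v ≠ some i)
    (h : gen k i ^ (a : ℕ) * u = gen k i ^ (b : ℕ) * v) : a = b ∧ u = v := by
  have key : ∀ (m : Multiplicative (ZMod k)) (x : FreeProd d k) (hx : firstSyllable x ≠ some i),
      Monoid.CoprodI.Word.equivPair i
        (Monoid.CoprodI.Word.equiv
          (Monoid.CoprodI.of (M := fun _ : Fin d => Multiplicative (ZMod k)) (i := i) m * x)) =
        ⟨m, Monoid.CoprodI.Word.equiv x, hx⟩ := by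
    intro m x hx
    have h1 : Monoid.CoprodI.Word.equiv
        (Monoid.CoprodI.of (M := fun _ : Fin d => Multiplicative (ZMod k)) (i := i) m * x) =
        Monoid.CoprodI.of (M := fun _ : Fin d => Multiplicative (ZMod k)) (i := i) m •
          Monoid.CoprodI.Word.equiv x := by
      simp [Monoid.CoprodI.Word.equiv, mul_smul]
    rw [h1, Monoid.CoprodI.Word.equivPair_smul_same,
      Monoid.CoprodI.Word.equivPair_eq_of_fstIdx_ne hx, mul_one]
  have h2 := key (Multiplicative.ofAdd ((a : ℕ) : ZMod k)) u hu
  rw [← gen_pow, h, gen_pow, key _ v hv] at h2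
  refine ⟨?_, Monoid.CoprodI.Word.equiv.injective
    (congrArg Monoid.CoprodI.Word.Pair.tail h2).symm⟩
  have h3 := (ZMod.natCast_eq_natCast_iff' _ _ _).1
    (Multiplicative.ofAdd.injective (congrArg Monoid.CoprodI.Word.Pair.head h2))
  rw [Nat.mod_eq_of_lt a.2, Nat.mod_eq_of_lt b.2] at h3
  exact Fin.ext h3.symm

/-- The counting step of the entropy inequality: the coordinate `j = sᵢ^a u`, where `u` does not
start with a power of `sᵢ`, is charged with `c u`, and each `u` occurs for at least `d - 1` indices
`i`. -/
theorem sum_sum_le_of_firstSyllable {D E : Finset (FreeProd d k)} [DecidableEq (FreeProd d k)]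
    {c : FreeProd d k → ℝ} (hc : ∀ u ∈ D, 0 ≤ c u) {m : Fin d → FreeProd d k → ℝ}
    (hm : ∀ i, ∀ j ∈ E, 0 ≤ m i j) (hE : ∀ i, ∀ a : Fin k, ∀ u ∈ D, gen k i ^ (a : ℕ) * u ∈ E)
    (hcm : ∀ i, ∀ a : Fin k, ∀ u ∈ D, c u ≤ m i (gen k i ^ (a : ℕ) * u)) :
    k * ((d - 1) * ∑ u ∈ D, c u) ≤ ∑ i, ∑ j ∈ E, m i j := by
  classical
  have h1 : ∀ i, k * ∑ u ∈ D with firstSyllable u ≠ some i, c u ≤ ∑ j ∈ E, m i j := by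
    intro i
    let P : Finset (Fin k × FreeProd d k) :=
      Finset.univ ×ˢ D.filter fun u => firstSyllable u ≠ some i
    have hinj : Set.InjOn (fun p : Fin k × FreeProd d k => gen k i ^ (p.1 : ℕ) * p.2) P := by
      rintro ⟨a, u⟩ hp ⟨b, v⟩ hq h
      simp only [P, Finset.coe_product, Finset.coe_univ, Set.mem_prod, Set.mem_univ, true_and,
        Finset.mem_coe, Finset.mem_filter] at hp hq
      obtain ⟨rfl, rfl⟩ := gen_pow_mul_inj hp.2 hq.2 h
      rfl
    have hsub : P.image (fun p => gen k i ^ (p.1 : ℕ) * p.2) ⊆ E := by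
      intro j hj
      obtain ⟨⟨a, u⟩, hp, rfl⟩ := Finset.mem_image.1 hj
      simp only [P, Finset.mem_product, Finset.mem_filter] at hp
      exact hE i a u hp.2.1
    refine le_trans ?_ (Finset.sum_le_sum_of_subset_of_nonneg hsub fun j hj _ => hm i j hj)
    rw [Finset.sum_image hinj, Finset.sum_product]
    have : (k : ℝ) * ∑ u ∈ D with firstSyllable u ≠ some i, c u =
        ∑ _a : Fin k, ∑ u ∈ D with firstSyllable u ≠ some i, c u := by simp
    rw [this]
    exact Finset.sum_le_sum fun a _ => Finset.sum_le_sum fun u hu =>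
      hcm i a u (Finset.mem_filter.1 hu).1
  refine le_trans ?_ (Finset.sum_le_sum fun i _ => h1 i)
  rw [← Finset.mul_sum]
  refine mul_le_mul_of_nonneg_left ?_ (Nat.cast_nonneg k)
  simp only [Finset.sum_filter]
  rw [Finset.sum_comm, Finset.mul_sum]
  refine Finset.sum_le_sum fun u hu => ?_
  rw [← Finset.sum_filter, Finset.sum_const, nsmul_eq_mul]
  refine mul_le_mul_of_nonneg_right ?_ (hc u hu)
  -- A reduced word starts in at most one free factor.
  have h2 : (Finset.univ.filter fun i => firstSyllable u = some i).card ≤ 1 :=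
    Finset.card_le_one.2 fun i hi j hj => by
      have := (Finset.mem_filter.1 hi).2.symm.trans (Finset.mem_filter.1 hj).2
      exact Option.some_injective _ this
  have h3 := Finset.card_filter_add_card_filter_not (s := (Finset.univ : Finset (Fin d)))
    (fun i => firstSyllable u = some i)
  rw [Finset.card_univ, Fintype.card_fin] at h3
  have h4 : (d : ℝ) ≤ 1 + (Finset.univ.filter fun i => ¬ firstSyllable u = some i).card := by
    exact_mod_cast (by omega)
  linarith

variable {Q : Type*}

/-- The exponents `a < k` for which `sᵢ^a` belongs to the random set `{g : g⁻¹ω ∈ Z}`. Here `g⁻¹ω`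
is the shift of `ω` by `g⁻¹`, which is `h ↦ ω (g h)`. -/
noncomputable def cosetPattern (Z : Set (FreeProd d k → Q)) (i : Fin d)
    (ω : FreeProd d k → Q) : Finset (Fin k) :=
  open Classical in
  Finset.univ.filter fun a => ω ∘ Equiv.mulLeft (gen k i ^ (a : ℕ)) ∈ Z

theorem mem_cosetPattern {Z : Set (FreeProd d k → Q)} {i : Fin d} {ω : FreeProd d k → Q}
    {a : Fin k} : a ∈ cosetPattern Z i ω ↔ ω ∘ Equiv.mulLeft (gen k i ^ (a : ℕ)) ∈ Z := by
  simp only [cosetPattern, Finset.mem_filter, Finset.mem_univ, true_and]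

theorem indicator_comp_mulLeft (Z : Set (FreeProd d k → Q)) (i : Fin d) (a : Fin k) :
    (fun ω => Z.indicator (1 : (FreeProd d k → Q) → ℝ) (ω ∘ Equiv.mulLeft (gen k i ^ (a : ℕ)))) =
      ∑ S ∈ Finset.univ.filter (fun S => a ∈ S),
        {ω | cosetPattern Z i ω = S}.indicator (1 : (FreeProd d k → Q) → ℝ) := by
  classical
  funext ω
  rw [Finset.sum_apply]
  simp only [Set.indicator_apply, Set.mem_ofPred_eq, Pi.one_apply]
  rw [Finset.sum_ite_eq]
  simp only [Finset.mem_filter, Finset.mem_univ, true_and, mem_cosetPattern]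

theorem dependsOn_indicator {ι Q : Type*} {Z : Set (ι → Q)} {s : Set ι}
    (h : DependsOn (· ∈ Z) s) : DependsOn (Z.indicator (1 : (ι → Q) → ℝ)) s := by
  classical
  intro ω ω' hω
  simp only [Set.indicator_apply]
  exact if_congr (iff_of_eq (h hω)) rfl rfl

theorem dependsOn_cosetPattern {Z : Set (FreeProd d k → Q)} {D E : Finset (FreeProd d k)}
    (hD : DependsOn (· ∈ Z) D) {i : Fin d}
    (hE : ∀ a : Fin k, ∀ u ∈ D, gen k i ^ (a : ℕ) * u ∈ E) :
    DependsOn (cosetPattern Z i) E := by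
  classical
  intro ω ω' h
  refine Finset.filter_congr fun a _ => iff_of_eq (hD fun u hu => ?_)
  exact h _ (hE a u hu)

/-- The entropy inequality for a set `Z` of configurations with finite window `D`, under i.i.d.
letters of law `w`. Only the nonempty patterns contribute to the right hand side. -/
theorem entropy_inequality [Fintype Q] [DecidableEq (FreeProd d k)] {w : Q → ℝ}
    (hw : w ∈ stdSimplex ℝ Q) {Z : Set (FreeProd d k → Q)}
    {D E : Finset (FreeProd d k)} (hD : DependsOn (· ∈ Z) D)
    (hE : ∀ i, ∀ a : Fin k, ∀ u ∈ D, gen k i ^ (a : ℕ) * u ∈ E) (ω : FreeProd d k → Q) :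
    k * ((d - 1) * Real.negMulLog (avgs w D (Z.indicator 1) ω)) ≤
      ∑ i, ∑ S ∈ Finset.univ.erase ∅,
        Real.negMulLog (avgs w E ({ω | cosetPattern Z i ω = S}.indicator 1) ω) := by
  classical
  set z : (FreeProd d k → Q) → ℝ := Z.indicator 1 with hz
  set p : Fin d → Finset (Fin k) → (FreeProd d k → Q) → ℝ :=
    fun i S => {ω | cosetPattern Z i ω = S}.indicator 1 with hp
  have hzD : DependsOn z D := dependsOn_indicator hD
  have hpE : ∀ i S, DependsOn (p i S) E := fun i S => dependsOn_indicator fun ω ω' h => by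
    change (cosetPattern Z i ω = S) = (cosetPattern Z i ω' = S)
    rw [dependsOn_cosetPattern hD (hE i) h]
  have hz0 : 0 ≤ z := fun ω => Set.indicator_nonneg (fun _ _ => zero_le_one) ω
  have hp0 : ∀ i S, 0 ≤ p i S := fun i S ω => Set.indicator_nonneg (fun _ _ => zero_le_one) ω
  have hind : ∀ (B : Set (FreeProd d k → Q)) ω, B.indicator (1 : (FreeProd d k → Q) → ℝ) ω = 0 ∨
      B.indicator (1 : (FreeProd d k → Q) → ℝ) ω = 1 := fun B ω => by
    rw [Set.indicator_apply]
    split_ifs <;> simp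
  -- The difference of the two sides when a random set of coordinates of density `s` has been
  -- revealed. It vanishes at `s = 1`, and it increases with `s`.
  let G : ℝ → ℝ := fun s => k * ((d - 1) * thin s D (condEnt w D z ω)) -
    ∑ i, ∑ S ∈ Finset.univ.erase ∅, thin s E (condEnt w E (p i S) ω)
  let G' : ℝ → ℝ := fun s => k * ((d - 1) * ∑ u ∈ D, thin s (D.erase u)
      fun A => condEnt w D z ω (insert u A) - condEnt w D z ω A) -
    ∑ i, ∑ S ∈ Finset.univ.erase ∅, ∑ j ∈ E, thin s (E.erase j)
      fun A => condEnt w E (p i S) ω (insert j A) - condEnt w E (p i S) ω A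
  have hG : ∀ s, HasDerivAt G (G' s) s := fun s =>
    (((hasDerivAt_thin s D _).const_mul _).const_mul _).sub
      (HasDerivAt.fun_sum fun i _ => HasDerivAt.fun_sum fun S _ => hasDerivAt_thin s E _)
  have hG0 : ∀ s, 0 ≤ s → s ≤ 1 → 0 ≤ G' s := by
    intro s h0 h1
    have key := sum_sum_le_of_firstSyllable (D := D) (E := E)
      (c := fun u => thin s (D.erase u) (entDrop w D z ω u))
      (m := fun i j => thin s (E.erase j) fun A =>
        ∑ S ∈ Finset.univ.erase ∅, entDrop w E (p i S) ω j A) ?_ ?_ hE ?_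
    · have e1 : ∀ u, (thin s (D.erase u) fun A =>
          condEnt w D z ω (insert u A) - condEnt w D z ω A) =
          - thin s (D.erase u) (entDrop w D z ω u) := fun u => by
        rw [thin_sub, show entDrop w D z ω u = fun A =>
          condEnt w D z ω A - condEnt w D z ω (insert u A) from rfl, thin_sub, neg_sub]
      have e2 : ∀ i S j, (thin s (E.erase j) fun A =>
          condEnt w E (p i S) ω (insert j A) - condEnt w E (p i S) ω A) =
          - thin s (E.erase j) (entDrop w E (p i S) ω j) := fun i S j => by
        rw [thin_sub, show entDrop w E (p i S) ω j = fun A =>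
          condEnt w E (p i S) ω A - condEnt w E (p i S) ω (insert j A) from rfl, thin_sub,
          neg_sub]
      simp only [thin_sum] at key
      simp only [G', e1, e2, Finset.sum_neg_distrib]
      rw [Finset.sum_congr rfl fun i _ => Finset.sum_comm] at key
      linarith
    · exact fun u hu => thin_nonneg h0 h1 fun A hA =>
        entDrop_nonneg hw hz0 ω hu fun h => Finset.notMem_erase _ _ (hA h)
    · exact fun i j hj => thin_nonneg h0 h1 fun A hA => Finset.sum_nonneg fun S _ =>
        entDrop_nonneg hw (hp0 i S) ω hj fun h => Finset.notMem_erase _ _ (hA h)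
    · intro i a u hu
      have hmap : D.map (Equiv.mulLeft (gen k i ^ (a : ℕ))).toEmbedding ⊆ E := by
        intro j hj
        obtain ⟨v, hv, rfl⟩ := Finset.mem_map.1 hj
        exact hE i a v hv
      have h2 := thin_entDrop_map hw.2 hzD (Equiv.mulLeft (gen k i ^ (a : ℕ))) hmap hu s ω
      rw [← h2, hz, indicator_comp_mulLeft]
      refine thin_mono h0 h1 fun A hA => ?_
      refine entDrop_sum_le hw (fun S hS => ?_) (hp0 i) ω (hE i a u hu)
        fun h => Finset.notMem_erase _ _ (hA h)
      refine Finset.mem_erase.2 ⟨?_, Finset.mem_univ _⟩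
      rintro rfl
      simp at hS
  have hmono : MonotoneOn G (Set.Icc 0 1) := by
    refine monotoneOn_of_deriv_nonneg (convex_Icc 0 1)
      (fun s _ => (hG s).continuousAt.continuousWithinAt)
      (fun s _ => (hG s).differentiableAt.differentiableWithinAt) fun s hs => ?_
    rw [interior_Icc] at hs
    rw [(hG s).deriv]
    exact hG0 s hs.1.le hs.2.le
  have h01 := hmono (by simp) (by simp) (zero_le_one (α := ℝ))
  simp only [G, thin_zero, thin_one, condEnt_empty hw.2 hzD, condEnt_empty hw.2 (hpE _ _),
    show condEnt w D z ω D = 0 from condEnt_self hw.2 (hind Z) ω,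
    show ∀ i S, condEnt w E (p i S) ω E = 0 from fun i S => condEnt_self hw.2 (hind _) ω] at h01
  simp only [mul_zero, Finset.sum_const_zero, sub_zero] at h01
  exact sub_nonpos.1 h01

end FreeProduct

/-! ### Sparse even sets and interpolation -/

section FiniteWindow

theorem avgs_comp_equiv_apply {ι Q : Type*} [DecidableEq ι] [Fintype Q] {w : Q → ℝ}
    (hw : ∑ q, w q = 1) {D E : Finset ι} {f : (ι → Q) → ℝ} (hf : DependsOn f D) (e : ι ≃ ι)
    (hE : ∀ u ∈ D, e u ∈ E) (ω ω' : ι → Q) :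
    avgs w E (fun ω => f (ω ∘ e)) ω = avgs w D f ω' := by
  have hf' : DependsOn (fun ω : ι → Q => f (ω ∘ e)) (D.map e.toEmbedding : Finset ι) :=
    fun ω ω' h => hf fun i hi => h (e i) (by simpa using hi)
  rw [avgs_eq_of_inter hw hf' (T' := D.map e.toEmbedding), avgs_comp_equiv]
  · exact avgs_apply_eq hf _ _
  · intro j hj
    refine iff_of_true ?_ hj
    obtain ⟨u, hu, rfl⟩ := Finset.mem_map.1 hj
    exact hE u hu

variable {d k : ℕ}

/-- If `Z` has density `δ` and its pattern on the coset `⟨sᵢ⟩` is odd with probability at most `ε`,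
then the pattern is nonempty with probability at most `kδ / 2 + ε`, which bounds its entropy. -/
theorem sum_negMulLog_cosetPattern_le [DecidableEq (FreeProd d k)] (hk : 0 < k) {Q : Type*}
    [Fintype Q] {w : Q → ℝ} (hw : w ∈ stdSimplex ℝ Q) {Z : Set (FreeProd d k → Q)}
    {D E : Finset (FreeProd d k)}
    (hD : DependsOn (· ∈ Z) D) {i : Fin d} (hE : ∀ a : Fin k, ∀ u ∈ D, gen k i ^ (a : ℕ) * u ∈ E)
    (ω : FreeProd d k → Q) {δ ε : ℝ} (hδ : avgs w D (Z.indicator 1) ω = δ) (hδ0 : 0 < δ)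
    (hδ1 : δ ≤ 1)
    (hodd : avgs w E ({ω | Odd (cosetPattern Z i ω).card}.indicator 1) ω ≤ ε) :
    ∑ S ∈ Finset.univ.erase ∅, Real.negMulLog
      (avgs w E ({ω | cosetPattern Z i ω = S}.indicator 1) ω) ≤
      (k * δ / 2 + ε) * (k * Real.log 2 - Real.log δ) := by
  classical
  set p : Finset (Fin k) → ℝ := fun S =>
    avgs w E ({ω | cosetPattern Z i ω = S}.indicator 1) ω with hp
  have hp0 : ∀ S, 0 ≤ p S := fun S =>
    avgs_nonneg hw.1 E (fun ω => Set.indicator_nonneg (fun _ _ => zero_le_one) ω) ω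
  set P := ∑ S ∈ Finset.univ.erase ∅, p S with hP
  have hPE : P = avgs w E ({ω | cosetPattern Z i ω ≠ ∅}.indicator 1) ω := by
    rw [hP, ← Finset.sum_apply, ← map_sum]
    refine congrArg (fun f => avgs w E f ω) (funext fun ω => ?_)
    rw [Finset.sum_apply]
    simp only [Set.indicator_apply, Set.mem_ofPred_eq, Pi.one_apply]
    rw [Finset.sum_ite_eq]
    simp
  have hshift : ∀ a : Fin k, avgs w E (fun ω => Z.indicator (1 : (FreeProd d k → Q) → ℝ)
      (ω ∘ Equiv.mulLeft (gen k i ^ (a : ℕ)))) ω = δ := fun a => by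
    rw [avgs_comp_equiv_apply hw.2 (dependsOn_indicator hD) _ (hE a) ω ω, hδ]
  have hPδ : δ ≤ P := by
    obtain ⟨a⟩ : Nonempty (Fin k) := ⟨⟨0, hk⟩⟩
    rw [hPE, ← hshift a]
    refine avgs_mono hw.1 E (fun ω => ?_) ω
    simp only [Set.indicator_apply, Set.mem_ofPred_eq, Pi.one_apply]
    split_ifs with h1 h2
    · rfl
    · exact absurd (mem_cosetPattern.2 h1) (not_not.1 h2 ▸ Finset.notMem_empty a)
    · exact zero_le_one
    · rfl
  -- A nonempty pattern is odd or has at least two elements, and its expected size is `k * δ`.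
  have hPle : P ≤ k * δ / 2 + ε := by
    have h1 : avgs w E ((1 / 2 : ℝ) • ∑ a : Fin k, (fun ω => Z.indicator
        (1 : (FreeProd d k → Q) → ℝ) (ω ∘ Equiv.mulLeft (gen k i ^ (a : ℕ)))) +
        {ω | Odd (cosetPattern Z i ω).card}.indicator 1) ω ≤ k * δ / 2 + ε := by
      rw [map_add, map_smul, map_sum, Pi.add_apply, Pi.smul_apply, Finset.sum_apply]
      simp only [hshift, Finset.sum_const, Finset.card_univ, Fintype.card_fin, nsmul_eq_mul,
        smul_eq_mul]
      linarith
    refine le_trans ?_ h1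
    rw [hPE]
    refine avgs_mono hw.1 E (fun ω => ?_) ω
    simp only [Pi.add_apply, Pi.smul_apply, Finset.sum_apply, smul_eq_mul]
    simp only [Set.indicator_apply, Set.mem_ofPred_eq, Pi.one_apply, ← mem_cosetPattern,
      Finset.sum_ite_mem, Finset.univ_inter, Finset.sum_const, nsmul_eq_mul, mul_one]
    rcases Nat.even_or_odd (cosetPattern Z i ω).card with h | h
    · rw [if_neg (Nat.not_odd_iff_even.2 h)]
      split_ifs with h2
      · obtain ⟨r, hr⟩ := h
        have : 1 ≤ r := by
          have := Finset.card_pos.2 (Finset.nonempty_iff_ne_empty.2 h2)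
          omega
        have : (1 : ℝ) ≤ r := by exact_mod_cast this
        rw [hr]
        push_cast
        linarith
      · positivity
    · rw [if_pos h]
      have : (0 : ℝ) ≤ 1 / 2 * (cosetPattern Z i ω).card := by positivity
      split_ifs <;> linarith
  -- Compare with weights `r` for each of the at most `2 ^ k` patterns.
  set r : ℝ := δ / 2 ^ k with hr
  have hr0 : 0 < r := by positivity
  have hlog : Real.log r = Real.log δ - k * Real.log 2 := by
    rw [hr, Real.log_div hδ0.ne' (by positivity), Real.log_pow]
  have h1 : ∀ S ∈ Finset.univ.erase (∅ : Finset (Fin k)),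
      Real.negMulLog (p S) ≤ p S * (k * Real.log 2 - Real.log δ) + (r - p S) := fun S _ => by
    have := Real.sub_le_mul_log_sub_mul_log (hp0 S) hr0.le fun h => absurd h hr0.ne'
    rw [hlog] at this
    rw [Real.negMulLog]
    linarith
  refine (Finset.sum_le_sum h1).trans ?_
  rw [Finset.sum_add_distrib, Finset.sum_sub_distrib, ← Finset.sum_mul, ← hP, Finset.sum_const,
    nsmul_eq_mul]
  have h2 : ((Finset.univ.erase (∅ : Finset (Fin k))).card : ℝ) * r ≤ δ := by
    have : ((Finset.univ.erase (∅ : Finset (Fin k))).card : ℝ) ≤ 2 ^ k := by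
      have := Finset.card_erase_le (s := Finset.univ) (a := (∅ : Finset (Fin k)))
      rw [Finset.card_univ, Fintype.card_finset, Fintype.card_fin] at this
      exact_mod_cast this
    calc _ ≤ 2 ^ k * r := mul_le_mul_of_nonneg_right this hr0.le
      _ = δ := by rw [hr]; field_simp
  have h3 : 0 ≤ k * Real.log 2 - Real.log δ :=
    sub_nonneg.2 ((Real.log_nonpos hδ0.le hδ1).trans (by positivity))
  have h4 := mul_le_mul_of_nonneg_right hPle h3
  linarith

/-- No finite-window factor of an i.i.d. process is a random set of density `2 ^ (-4dk)` which has,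
up to a comparable small probability, even intersections with the cosets of the free factors. -/
theorem not_sparse_even_set [DecidableEq (FreeProd d k)] (hd : 3 ≤ d) (hk : 0 < k) {Q : Type*}
    [Fintype Q] {w : Q → ℝ} (hw : w ∈ stdSimplex ℝ Q) {Z : Set (FreeProd d k → Q)}
    {D E : Finset (FreeProd d k)}
    (hD : DependsOn (· ∈ Z) D) (hE : ∀ i, ∀ a : Fin k, ∀ u ∈ D, gen k i ^ (a : ℕ) * u ∈ E)
    (ω : FreeProd d k → Q) (hδ : avgs w D (Z.indicator 1) ω = (1 / 2 : ℝ) ^ (4 * d * k))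
    (hodd : ∀ i, avgs w E ({ω | Odd (cosetPattern Z i ω).card}.indicator 1) ω ≤
      k * (1 / 2 : ℝ) ^ (4 * d * k) / (4 * d)) : False := by
  set δ : ℝ := (1 / 2 : ℝ) ^ (4 * d * k) with hδd
  have hδ0 : 0 < δ := by positivity
  have hδ1 : δ ≤ 1 := pow_le_one₀ (by norm_num) (by norm_num)
  have h1 := entropy_inequality hw hD hE ω
  have h2 := h1.trans (Finset.sum_le_sum fun i _ =>
    sum_negMulLog_cosetPattern_le hk hw hD (hE i) ω hδ hδ0 hδ1 (hodd i))
  rw [hδ, Finset.sum_const, Finset.card_univ, Fintype.card_fin, nsmul_eq_mul, Real.negMulLog] at h2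
  have hlog : Real.log δ = -(4 * d * (k * Real.log 2)) := by
    rw [hδd, Real.log_pow, one_div, Real.log_inv]
    push_cast
    ring
  rw [hlog] at h2
  have hd' : (3 : ℝ) ≤ d := by exact_mod_cast hd
  have hk' : (0 : ℝ) < k := by exact_mod_cast hk
  have hM : 0 < k * Real.log 2 := mul_pos hk' (Real.log_pos one_lt_two)
  set M := k * Real.log 2
  have h3 : (d : ℝ) * ((k * δ / 2 + k * δ / (4 * d)) * (M - -(4 * d * M))) =
      (k * δ * M) * ((d / 2 + 1 / 4) * (4 * d + 1)) := by
    field_simp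
    ring
  have h4 : (k : ℝ) * ((d - 1) * (-δ * -(4 * d * M))) = (k * δ * M) * ((d - 1) * (4 * d)) := by
    ring
  rw [h3, h4] at h2
  -- `h5` reads `(d - 1) * 4d ≤ (d / 2 + 1 / 4) * (4d + 1)`, which fails from `d = 3` on.
  have h5 := le_of_mul_le_mul_left h2 (by positivity)
  nlinarith

/-- The law of a pair of letters of law `w` which are equal with probability `1 - t` and
independent with probability `t`. -/
noncomputable def coupling {Q : Type*} [DecidableEq Q] (w : Q → ℝ) (t : ℝ) (x : Q × Q) : ℝ :=
  (1 - t) * (if x.1 = x.2 then w x.1 else 0) + t * (w x.1 * w x.2)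

theorem sum_coupling {Q : Type*} [Fintype Q] [DecidableEq Q] (w : Q → ℝ) (t : ℝ) (g : Q × Q → ℝ) :
    ∑ x, coupling w t x * g x =
      (1 - t) * ∑ a, w a * g (a, a) + t * ∑ a, ∑ b, w a * w b * g (a, b) := by
  simp only [coupling, add_mul, Finset.sum_add_distrib, Fintype.sum_prod_type, Finset.mul_sum]
  congr 1
  · refine Finset.sum_congr rfl fun a _ => ?_
    simp [ite_mul, mul_assoc]
  · simp only [mul_assoc]

theorem coupling_mem_stdSimplex {Q : Type*} [Fintype Q] [DecidableEq Q] {w : Q → ℝ}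
    (hw : w ∈ stdSimplex ℝ Q) {t : ℝ} (h0 : 0 ≤ t) (h1 : t ≤ 1) :
    coupling w t ∈ stdSimplex ℝ (Q × Q) := by
  refine ⟨fun x => add_nonneg (mul_nonneg (sub_nonneg.2 h1) ?_)
    (mul_nonneg h0 (mul_nonneg (hw.1 _) (hw.1 _))), ?_⟩
  · split_ifs
    exacts [hw.1 _, le_rfl]
  · simpa [← Finset.mul_sum, hw.2] using sum_coupling w t fun _ => 1

theorem sum_coupling_fst {Q : Type*} [Fintype Q] [DecidableEq Q] {w : Q → ℝ}
    (hw : ∑ q, w q = 1) (t : ℝ) (g : Q → ℝ) :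
    ∑ x, coupling w t x * g x.1 = ∑ q, w q * g q := by
  rw [sum_coupling w t fun x => g x.1]
  simp only [mul_right_comm (w _) (w _), ← Finset.mul_sum, hw]
  ring_nf

theorem sum_coupling_snd {Q : Type*} [Fintype Q] [DecidableEq Q] {w : Q → ℝ}
    (hw : ∑ q, w q = 1) (t : ℝ) (g : Q → ℝ) :
    ∑ x, coupling w t x * g x.2 = ∑ q, w q * g q := by
  rw [sum_coupling w t fun x => g x.2]
  simp only [mul_assoc, ← Finset.mul_sum, ← Finset.sum_mul, hw]
  ring

theorem cosetPattern_symmDiff {Q : Type*} (Y : Set (FreeProd d k → Q)) (i : Fin d)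
    (ω : FreeProd d k → Q × Q) :
    cosetPattern {ω : FreeProd d k → Q × Q | Xor (Prod.fst ∘ ω ∈ Y) (Prod.snd ∘ ω ∈ Y)} i ω =
      symmDiff (cosetPattern Y i (Prod.fst ∘ ω)) (cosetPattern Y i (Prod.snd ∘ ω)) := by
  ext a
  rw [Finset.mem_symmDiff, mem_cosetPattern, mem_cosetPattern, mem_cosetPattern]
  exact Iff.rfl

theorem Finset.odd_card_symmDiff {α : Type*} [DecidableEq α] {s t : Finset α}
    (h : Odd (symmDiff s t).card) : Odd s.card ∨ Odd t.card := by
  have h1 : (symmDiff s t).card = (s \ t).card + (t \ s).card :=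
    Finset.card_union_of_disjoint disjoint_sdiff_sdiff
  have h2 := Finset.card_sdiff_add_card_inter s t
  have h3 := Finset.card_sdiff_add_card_inter t s
  rw [Finset.inter_comm] at h3
  by_contra! hc
  rw [Nat.not_odd_iff_even, Nat.not_odd_iff_even] at hc
  rw [h1] at h
  obtain ⟨a, ha⟩ := hc.1
  obtain ⟨b, hb⟩ := hc.2
  obtain ⟨c, hc⟩ := h
  omega

/-- No finite-window factor of an i.i.d. process is a random set of density `p` bounded away from
`0` and `1` with almost surely even intersections with the cosets of the free factors, up to small
error. The proof interpolates between two independent copies to get a sparse set of this kind. -/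
theorem not_even_block_factor [DecidableEq (FreeProd d k)] (hd : 3 ≤ d) (hk : 0 < k) {Q : Type*}
    [Fintype Q] {w : Q → ℝ} (hw : w ∈ stdSimplex ℝ Q) {Y : Set (FreeProd d k → Q)}
    {D E : Finset (FreeProd d k)}
    (hD : DependsOn (· ∈ Y) D) (hE : ∀ i, ∀ a : Fin k, ∀ u ∈ D, gen k i ^ (a : ℕ) * u ∈ E)
    (ω : FreeProd d k → Q) {p : ℝ} (hp : avgs w D (Y.indicator 1) ω = p)
    (hp0 : (1 / 2 : ℝ) ^ (4 * d * k) ≤ 2 * p * (1 - p))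
    (hodd : ∀ i, avgs w E ({ω | Odd (cosetPattern Y i ω).card}.indicator 1) ω ≤
      k * (1 / 2 : ℝ) ^ (4 * d * k) / (8 * d)) : False := by
  classical
  set Z : Set (FreeProd d k → Q × Q) :=
    {ω | Xor (Prod.fst ∘ ω ∈ Y) (Prod.snd ∘ ω ∈ Y)} with hZ
  have hZD : DependsOn (· ∈ Z) D := fun x y h => by
    change Xor (Prod.fst ∘ x ∈ Y) (Prod.snd ∘ x ∈ Y) = Xor (Prod.fst ∘ y ∈ Y) (Prod.snd ∘ y ∈ Y)
    rw [show (Prod.fst ∘ x ∈ Y) = (Prod.fst ∘ y ∈ Y) from hD fun i hi => congrArg Prod.fst (h i hi),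
      show (Prod.snd ∘ x ∈ Y) = (Prod.snd ∘ y ∈ Y) from hD fun i hi => congrArg Prod.snd (h i hi)]
  let ω₂ : FreeProd d k → Q × Q := fun g => (ω g, ω g)
  let h : ℝ → ℝ := fun t => avgs (coupling w t) D (Z.indicator 1) ω₂
  have hcont : Continuous h := continuous_avgs (fun q => by unfold coupling; fun_prop) D _ _
  -- At `t = 0` the two letters of each pair are equal: the law is that of the diagonal.
  have h0 : h 0 = 0 := by
    have := avgs_comp_map (r := fun q : Q => (q, q)) (w := coupling w 0) (v := w)
      (fun g => by rw [sum_coupling]; simp) D (Z.indicator 1)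
    have h2 := congrFun this ω
    have h3 : (fun ω : FreeProd d k → Q => Z.indicator (1 : (FreeProd d k → Q × Q) → ℝ)
        ((fun q => (q, q)) ∘ ω)) = fun _ => 0 := by
      funext ω
      refine Set.indicator_of_notMem (fun h => ?_) _
      exact (xor_self _).mp h
    rw [h3, avgs_const hw.2] at h2
    exact h2.symm
  have h1 : h 1 = 2 * p * (1 - p) := by
    have e1 : Z.indicator (1 : (FreeProd d k → Q × Q) → ℝ) =
        (fun ω => Y.indicator 1 (Prod.fst ∘ ω)) + (fun ω => Y.indicator 1 (Prod.snd ∘ ω)) -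
        (2 : ℝ) • fun ω => Y.indicator 1 (Prod.fst ∘ ω) * Y.indicator 1 (Prod.snd ∘ ω) := by
      funext ω
      by_cases h1 : Prod.fst ∘ ω ∈ Y <;> by_cases h2 : Prod.snd ∘ ω ∈ Y <;>
        norm_num [Set.indicator_apply, hZ, Xor, h1, h2]
    have e2 : (Prod.fst ∘ ω₂) = ω := rfl
    have e3 : (Prod.snd ∘ ω₂) = ω := rfl
    change avgs (coupling w 1) D (Z.indicator 1) ω₂ = _
    rw [e1, map_sub, map_add, map_smul, avgs_comp_map (sum_coupling_fst hw.2 1),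
      avgs_comp_map (sum_coupling_snd hw.2 1),
      avgs_mul_of_indep (w := w) (v := coupling w 1) (r := Prod.fst) (r' := Prod.snd)]
    · simp only [Pi.sub_apply, Pi.add_apply, Pi.smul_apply, e2, e3, hp, smul_eq_mul]
      ring
    · intro g g'
      rw [sum_coupling w 1 fun x => g x.1 * g' x.2, Finset.sum_mul_sum]
      simp only [sub_self, zero_mul, zero_add, one_mul]
      refine Finset.sum_congr rfl fun a _ => Finset.sum_congr rfl fun b _ => by ring
  obtain ⟨t, ht, hht⟩ := intermediate_value_Icc zero_le_one hcont.continuousOn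
    (show (1 / 2 : ℝ) ^ (4 * d * k) ∈ Set.Icc (h 0) (h 1) from
      ⟨by rw [h0]; positivity, h1 ▸ hp0⟩)
  have hv := coupling_mem_stdSimplex hw ht.1 ht.2
  refine not_sparse_even_set hd hk hv hZD hE ω₂ hht fun i => ?_
  set O : (FreeProd d k → Q) → ℝ := {ω | Odd (cosetPattern Y i ω).card}.indicator 1 with hO
  have h2 : avgs (coupling w t) E ((fun ω => O (Prod.fst ∘ ω)) + fun ω => O (Prod.snd ∘ ω)) ω₂ ≤
      k * (1 / 2 : ℝ) ^ (4 * d * k) / (8 * d) + k * (1 / 2 : ℝ) ^ (4 * d * k) / (8 * d) := by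
    rw [map_add, avgs_comp_map (sum_coupling_fst hw.2 t), avgs_comp_map (sum_coupling_snd hw.2 t)]
    exact add_le_add (hodd i) (hodd i)
  refine (le_trans (avgs_mono hv.1 E (fun ω => ?_) ω₂) h2).trans (le_of_eq ?_)
  · have hO0 : ∀ ω, 0 ≤ O ω := fun ω => Set.indicator_nonneg (fun _ _ => zero_le_one) ω
    rw [Pi.add_apply]
    by_cases hω : Odd (cosetPattern Z i ω).card
    · rw [Set.indicator_of_mem (by exact hω)]
      rw [hZ, cosetPattern_symmDiff] at hω
      rcases Finset.odd_card_symmDiff hω with h | h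
      · have : O (Prod.fst ∘ ω) = 1 := Set.indicator_of_mem (by exact h) _
        rw [this]
        exact le_add_of_nonneg_right (hO0 _)
      · have : O (Prod.snd ∘ ω) = 1 := Set.indicator_of_mem (by exact h) _
        rw [this]
        exact le_add_of_nonneg_left (hO0 _)
    · rw [Set.indicator_of_notMem (by exact hω)]
      exact add_nonneg (hO0 _) (hO0 _)
  · have : (d : ℝ) ≠ 0 := by
      have : d ≠ 0 := by omega
      exact_mod_cast this
    field_simp
    norm_num

end FiniteWindow

/-! ### Averages as integrals against product measures -/

section ProductMeasure

/-- Resampling one coordinate preserves the product measure. -/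
theorem measurePreserving_update {ι Q : Type*} [DecidableEq ι] [MeasurableSpace Q] (κ : Measure Q)
    [IsProbabilityMeasure κ] (j : ι) :
    MeasurePreserving (fun x : (ι → Q) × Q => Function.update x.1 j x.2)
      ((Measure.infinitePi fun _ : ι => κ).prod κ) (Measure.infinitePi fun _ : ι => κ) := by
  have hm : Measurable fun x : (ι → Q) × Q => Function.update x.1 j x.2 := by
    refine measurable_pi_lambda _ fun i => ?_
    rcases eq_or_ne i j with rfl | h
    · simpa using measurable_snd
    · simp only [Function.update_of_ne h]
      exact (measurable_pi_apply i).comp measurable_fst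
  refine ⟨hm, Measure.eq_infinitePi _ fun s t ht => ?_⟩
  rw [Measure.map_apply hm (.pi s.countable_toSet fun _ _ => ht _)]
  by_cases hj : j ∈ s
  · have : (fun x : (ι → Q) × Q => Function.update x.1 j x.2) ⁻¹' Set.pi s t =
        Set.pi (s.erase j : Finset ι) t ×ˢ t j := by
      ext x
      simp only [Set.mem_preimage, Set.mem_pi, Finset.mem_coe, Set.mem_prod, Finset.mem_erase]
      constructor
      · intro h
        refine ⟨fun i hi => ?_, by simpa using h j hj⟩
        have := h i hi.2
        rwa [Function.update_of_ne hi.1] at this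
      · rintro ⟨h1, h2⟩ i hi
        rcases eq_or_ne i j with rfl | hij
        · simpa using h2
        · rw [Function.update_of_ne hij]
          exact h1 i ⟨hij, hi⟩
    rw [this, Measure.prod_prod, Measure.infinitePi_pi _ fun i _ => ht i,
      Finset.prod_erase_mul _ _ hj]
  · have : (fun x : (ι → Q) × Q => Function.update x.1 j x.2) ⁻¹' Set.pi s t =
        Set.pi s t ×ˢ Set.univ := by
      ext x
      simp only [Set.mem_preimage, Set.mem_pi, Finset.mem_coe, Set.mem_prod, Set.mem_univ,
        and_true]
      refine forall₂_congr fun i hi => ?_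
      rw [Function.update_of_ne (ne_of_mem_of_not_mem hi hj)]
    rw [this, Measure.prod_prod, Measure.infinitePi_pi _ fun i _ => ht i, measure_univ, mul_one]

theorem DependsOn.exists_factor {ι Q β : Type*} [Nonempty β] {f : (ι → Q) → β} {D : Finset ι}
    (hf : DependsOn f D) : ∃ g : (D → Q) → β, f = fun ω => g fun i => ω i := by
  obtain ⟨g, hg⟩ := dependsOn_iff_exists_comp.1 hf
  exact ⟨g, hg⟩

theorem DependsOn.measurable_of_finite {ι Q β : Type*} [Nonempty β] [MeasurableSpace β] [Finite Q]
    [MeasurableSpace Q] [DiscreteMeasurableSpace Q] {f : (ι → Q) → β} {D : Finset ι}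
    (hf : DependsOn f D) : Measurable f := by
  obtain ⟨g, rfl⟩ := hf.exists_factor
  exact (Measurable.of_discrete (f := g)).comp
    (measurable_pi_lambda _ fun i => measurable_pi_apply _)

theorem DependsOn.integrable_of_finite {ι Q : Type*} [Finite Q] [MeasurableSpace Q]
    [DiscreteMeasurableSpace Q] {f : (ι → Q) → ℝ} {D : Finset ι}
    (hf : DependsOn f D) (μ : Measure (ι → Q)) [IsFiniteMeasure μ] : Integrable f μ := by
  have hm := hf.measurable_of_finite
  obtain ⟨g, rfl⟩ := hf.exists_factor
  obtain ⟨C, hC⟩ := (Set.finite_range fun x => ‖g x‖).bddAbove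
  exact Integrable.of_bound hm.aestronglyMeasurable C (ae_of_all _ fun ω => hC ⟨_, rfl⟩)

theorem integral_avg {ι Q : Type*} [DecidableEq ι] [Fintype Q] [MeasurableSpace Q]
    [DiscreteMeasurableSpace Q] (κ : Measure Q) [IsProbabilityMeasure κ] {f : (ι → Q) → ℝ}
    {D : Finset ι} (hf : DependsOn f D) (j : ι) :
    ∫ ω, avg (fun q => κ.real {q}) j f ω ∂(Measure.infinitePi fun _ : ι => κ) =
      ∫ ω, f ω ∂(Measure.infinitePi fun _ : ι => κ) := by
  have hmp := measurePreserving_update κ j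
  have hint : Integrable (fun x : (ι → Q) × Q => f (Function.update x.1 j x.2)) _ :=
    hmp.integrable_comp_of_integrable
    (hf.integrable_of_finite (Measure.infinitePi fun _ : ι => κ))
  conv_rhs => rw [← hmp.map_eq]
  rw [integral_map hmp.measurable.aemeasurable
    hf.measurable_of_finite.aestronglyMeasurable, integral_prod (fun x : (ι → Q) × Q =>
      f (Function.update x.1 j x.2)) hint]
  refine integral_congr_ae (ae_of_all _ fun ω => ?_)
  simp only
  rw [integral_fintype Integrable.of_finite]
  rfl

theorem avgs_eq_integral {ι Q : Type*} [DecidableEq ι] [Fintype Q] [MeasurableSpace Q]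
    [DiscreteMeasurableSpace Q] (κ : Measure Q) [IsProbabilityMeasure κ] {f : (ι → Q) → ℝ}
    {D : Finset ι} (hf : DependsOn f D) (ω : ι → Q) :
    avgs (fun q => κ.real {q}) D f ω = ∫ ω, f ω ∂(Measure.infinitePi fun _ : ι => κ) := by
  have h : ∀ T : Finset ι, ∫ ω, avgs (fun q => κ.real {q}) T f ω
      ∂(Measure.infinitePi fun _ : ι => κ) = ∫ ω, f ω ∂(Measure.infinitePi fun _ : ι => κ) := by
    intro T
    induction T using Finset.induction_on with
    | empty => simp
    | insert j T hj ih =>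
      rw [avgs_insert _ hj, integral_avg κ ((hf.avgs T).mono Set.sdiff_subset), ih]
  rw [← h D, integral_congr_ae (ae_of_all _ fun ω' => avgs_apply_eq hf ω' ω)]
  simp

theorem avgs_indicator_eq_measureReal {ι K Q : Type*} [DecidableEq ι] [MeasurableSpace K]
    (κ : Measure K) [IsProbabilityMeasure κ] [Fintype Q] [MeasurableSpace Q]
    [DiscreteMeasurableSpace Q] {π : K → Q} (hπ : Measurable π) {Y : Set (ι → Q)}
    {D : Finset ι} (hY : DependsOn (· ∈ Y) D) (ω : ι → Q) :
    avgs (fun q => κ.real (π ⁻¹' {q})) D (Y.indicator 1) ω =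
      (Measure.infinitePi fun _ : ι => κ).real {ω | π ∘ ω ∈ Y} := by
  have : IsProbabilityMeasure (κ.map π) := Measure.isProbabilityMeasure_map hπ.aemeasurable
  have h1 : (fun q => κ.real (π ⁻¹' {q})) = fun q => (κ.map π).real {q} := by
    funext q
    rw [map_measureReal_apply hπ (MeasurableSet.singleton q)]
  have hYm : MeasurableSet Y := measurableSet_setOfPred.2 hY.measurable_of_finite
  rw [h1, avgs_eq_integral (κ.map π) (dependsOn_indicator hY), integral_indicator_one hYm,
    ← Measure.infinitePi_map_pi _ fun _ => hπ, map_measureReal_apply (by fun_prop) hYm]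
  rfl

end ProductMeasure

/-! ### Approximation by sets with a finite window -/

section Approximation

variable (ι K : Type*) [MeasurableSpace K]

/-- The sets of configurations `ω : ι → K` that depend on finitely many coordinates, each through a
measurable map `π` to a finite type. The alphabet ranges over `Type`, which loses no generality. -/
def finiteWindowSets : Set (Set (ι → K)) :=
  {B | ∃ (Q : Type) (_ : Finite Q) (π : K → Q) (D : Finset ι) (Y : Set (ι → Q)),
    (∀ q, MeasurableSet (π ⁻¹' {q})) ∧ DependsOn (· ∈ Y) D ∧ B = {ω | π ∘ ω ∈ Y}}

theorem isSetAlgebra_finiteWindowSets : IsSetAlgebra (finiteWindowSets ι K) where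
  empty_mem := ⟨Unit, inferInstance, fun _ => (), ∅, ∅, fun _ => by simp,
    fun _ _ _ => rfl, by ext; simp⟩
  compl_mem := by
    rintro _ ⟨Q, hQ, π, D, Y, hπ, hY, rfl⟩
    exact ⟨Q, hQ, π, D, Yᶜ, hπ, fun x y h => congrArg Not (hY h), rfl⟩
  union_mem := by
    classical
    rintro _ _ ⟨Q, hQ, π, D, Y, hπ, hY, rfl⟩ ⟨Q', hQ', π', D', Y', hπ', hY', rfl⟩
    refine ⟨Q × Q', inferInstance, fun x => (π x, π' x), D ∪ D',
      {ω | Prod.fst ∘ ω ∈ Y ∨ Prod.snd ∘ ω ∈ Y'}, ?_, ?_, rfl⟩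
    · rintro ⟨q, q'⟩
      have : (fun x => (π x, π' x)) ⁻¹' {(q, q')} = π ⁻¹' {q} ∩ π' ⁻¹' {q'} := by
        ext x
        simp
      rw [this]
      exact (hπ q).inter (hπ' q')
    · intro x y h
      exact congrArg₂ Or
        (hY fun i hi => congrArg Prod.fst (h i (Finset.mem_union_left _ hi)))
        (hY' fun i hi => congrArg Prod.snd (h i (Finset.mem_union_right _ hi)))

theorem generateFrom_finiteWindowSets :
    (MeasurableSpace.pi : MeasurableSpace (ι → K)) =
      MeasurableSpace.generateFrom (finiteWindowSets ι K) := by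
  refine le_antisymm (iSup_le fun i => ?_) (MeasurableSpace.generateFrom_le ?_)
  · rintro _ ⟨s, hs, rfl⟩
    refine MeasurableSpace.measurableSet_generateFrom
      ⟨Prop, inferInstance, (· ∈ s), {i}, {ω | ω i}, fun q => ?_, fun x y h => ?_, rfl⟩
    · have : Measurable (· ∈ s) := measurable_mem.2 hs
      exact this (MeasurableSet.singleton q)
    · exact h i (by simp)
  · rintro _ ⟨Q, hQ, π, D, Y, hπ, hY, rfl⟩
    let _ : MeasurableSpace Q := ⊤
    have hπ' : Measurable π := measurable_to_countable' hπ
    have hYm : MeasurableSet Y := measurableSet_setOfPred.2 hY.measurable_of_finite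
    exact (measurable_pi_lambda (fun ω : ι → K => π ∘ ω)
      fun i => hπ'.comp (measurable_pi_apply i)) hYm

theorem exists_finiteWindowSet_measureReal_symmDiff_lt {ι K : Type*} [MeasurableSpace K]
    (μ : Measure (ι → K)) [IsFiniteMeasure μ] {B : Set (ι → K)} (hB : MeasurableSet B) {ε : ℝ}
    (hε : 0 < ε) : ∃ B' ∈ finiteWindowSets ι K, MeasurableSet B' ∧ μ.real (symmDiff B B') < ε := by
  have h := Measure.MeasureDense.of_generateFrom_isSetAlgebra_finite μ
    (isSetAlgebra_finiteWindowSets ι K) (generateFrom_finiteWindowSets ι K)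
  obtain ⟨B', hB', hlt⟩ := h.approx B hB (measure_ne_top μ B) ε hε
  exact ⟨B', hB', h.measurable B' hB', ENNReal.toReal_lt_of_lt_ofReal hlt⟩

end Approximation

/-! ### Weak containment and linear relations between indicators -/

section WeakContainment

variable {Γ : Type*} [Group Γ] {X : Type*} [MeasurableSpace X] {μ : Measure X}
  [IsProbabilityMeasure μ] {Y : Type*} [MeasurableSpace Y] {ν : Measure Y} [IsProbabilityMeasure ν]

theorem PMPAction.image_eq_preimage (a : PMPAction Γ X μ) (γ : Γ) (A : Set X) :
    a.act γ '' A = a.act γ⁻¹ ⁻¹' A := by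
  refine congrFun (Set.image_eq_preimage_of_inverse (fun x => ?_) fun x => ?_) A
  · rw [← a.act_mul, inv_mul_cancel, a.act_one]
  · rw [← a.act_mul, mul_inv_cancel, a.act_one]

theorem PMPAction.image_one (a : PMPAction Γ X μ) (A : Set X) : a.act 1 '' A = A := by
  rw [a.image_eq_preimage, inv_one, show a.act 1 = id from funext a.act_one, Set.preimage_id]

theorem PMPAction.measurableSet_image (a : PMPAction Γ X μ) (γ : Γ) {A : Set X}
    (hA : MeasurableSet A) : MeasurableSet (a.act γ '' A) := by
  rw [a.image_eq_preimage]
  exact (a.measurePreserving _).measurable hA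

theorem PMPAction.measureReal_image_inter_image (a : PMPAction Γ X μ) (γ γ' : Γ) {A B : Set X}
    (hA : MeasurableSet A) (hB : MeasurableSet B) :
    μ.real (a.act γ '' A ∩ a.act γ' '' B) = μ.real (a.act (γ'⁻¹ * γ) '' A ∩ B) := by
  rw [← (a.measurePreserving γ'⁻¹).measureReal_preimage
    ((a.measurableSet_image _ hA).inter hB).nullMeasurableSet]
  congr 1
  rw [Set.preimage_inter, a.image_eq_preimage, a.image_eq_preimage, a.image_eq_preimage,
    ← Set.preimage_comp]
  congr 2
  funext x
  simp [← a.act_mul]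

/-- Weak containment controls the pairwise intersections of arbitrary translates, and the sets may
be indexed by any finite type. -/
theorem WeaklyContained.exists_translates {a : PMPAction Γ X μ} {b : PMPAction Γ Y ν}
    (h : WeaklyContained a b) {ι : Type*} [Finite ι] {A : ι → Set X}
    (hA : ∀ i, MeasurableSet (A i)) (F : Finset Γ) {ε : ℝ} (hε : 0 < ε) :
    ∃ B : ι → Set Y, (∀ i, MeasurableSet (B i)) ∧ ∀ γ ∈ F, ∀ γ' ∈ F, ∀ i j,
      |μ.real (a.act γ '' A i ∩ a.act γ' '' A j) - ν.real (b.act γ '' B i ∩ b.act γ' '' B j)|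
        < ε := by
  classical
  obtain ⟨n, ⟨e⟩⟩ := Finite.exists_equiv_fin ι
  obtain ⟨B, hB, hAB⟩ := h n (A ∘ e.symm) (fun i => hA _)
    (Finset.image₂ (fun γ γ' => γ'⁻¹ * γ) F F) ε hε
  refine ⟨B ∘ e, fun i => hB _, fun γ hγ γ' hγ' i j => ?_⟩
  rw [a.measureReal_image_inter_image γ γ' (hA i) (hA j),
    b.measureReal_image_inter_image γ γ' (A := (B ∘ e) i) (B := (B ∘ e) j) (hB _) (hB _)]
  simpa using hAB _ (Finset.mem_image₂_of_mem hγ hγ') (e i) (e j)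

open Classical in
theorem sum_indicator_one_apply {α L : Type*} [Fintype L] (s : L → Set α) (x : α) :
    ∑ l, (s l).indicator (1 : α → ℝ) x = (Finset.univ.filter fun l => x ∈ s l).card := by
  simp [Set.indicator_apply, Finset.sum_boole]

theorem integral_sq_sum_indicator {L : Type*} [Fintype L] {U : L → Set X}
    (hU : ∀ l, MeasurableSet (U l)) (c : L → ℝ) :
    ∫ x, (∑ l, c l * (U l).indicator 1 x) ^ 2 ∂μ =
      ∑ l, ∑ m, c l * c m * μ.real (U l ∩ U m) := by
  have h : ∀ x, (∑ l, c l * (U l).indicator (1 : X → ℝ) x) ^ 2 =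
      ∑ l, ∑ m, c l * c m * (U l ∩ U m).indicator (1 : X → ℝ) x := fun x => by
    rw [sq, Finset.sum_mul_sum]
    refine Finset.sum_congr rfl fun l _ => Finset.sum_congr rfl fun m _ => ?_
    rw [Set.inter_indicator_one, Pi.mul_apply]
    ring
  have hint : ∀ l m, Integrable (fun x => c l * c m * (U l ∩ U m).indicator (1 : X → ℝ) x) μ :=
    fun l m => ((integrable_const (1 : ℝ)).indicator ((hU l).inter (hU m))).const_mul _
  simp only [h]
  rw [integral_finsetSum _ fun l _ => integrable_finsetSum _ fun m _ => hint l m]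
  refine Finset.sum_congr rfl fun l _ => ?_
  rw [integral_finsetSum _ fun m _ => hint l m]
  refine Finset.sum_congr rfl fun m _ => ?_
  rw [integral_const_mul, integral_indicator_one ((hU l).inter (hU m))]

/-- Linear relations between indicator functions are almost preserved when the measures of pairwise
intersections are: these measures determine the `L²` norm. -/
theorem integral_sq_sum_indicator_le {L : Type*} [Fintype L] {U : L → Set X} {V : L → Set Y}
    (hU : ∀ l, MeasurableSet (U l)) (hV : ∀ l, MeasurableSet (V l)) (c : L → ℝ) {ε : ℝ}
    (hUV : ∀ l m, |μ.real (U l ∩ U m) - ν.real (V l ∩ V m)| ≤ ε) :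
    ∫ y, (∑ l, c l * (V l).indicator 1 y) ^ 2 ∂ν ≤
      ∫ x, (∑ l, c l * (U l).indicator 1 x) ^ 2 ∂μ + (∑ l, |c l|) ^ 2 * ε := by
  rw [integral_sq_sum_indicator hU, integral_sq_sum_indicator hV, sq, Finset.sum_mul_sum,
    Finset.sum_mul, ← Finset.sum_add_distrib]
  refine Finset.sum_le_sum fun l _ => ?_
  rw [Finset.sum_mul, ← Finset.sum_add_distrib]
  refine Finset.sum_le_sum fun m _ => ?_
  have h1 := mul_le_mul_of_nonneg_left (hUV l m) (abs_nonneg (c l * c m))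
  rw [← abs_mul] at h1
  rw [← abs_mul]
  have h2 := neg_le_of_abs_le h1
  rw [mul_sub] at h2
  linarith

end WeakContainment

/-! ### Even sets from the parity check system -/

section ParitySystem

variable {d k : ℕ}

theorem measurableSet_apply_eq_one (g : FreeProd d k) :
    MeasurableSet {x : parityCheck d k | x.1 g = 1} := by
  have h : Measurable fun x : parityCheck d k => x.1 g :=
    (measurable_pi_apply g).comp measurable_subtype_coe
  exact h (MeasurableSet.singleton 1)

/-- Translation by an element of `X` whose coordinate at the identity is `1` exchanges `{x | x e =
1}` and its complement. Such an element is pulled back from the cyclic group of order `k` along the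
homomorphism that maps every `sᵢ` to `1`. -/
theorem parityHaar_real_half (hk : 2 ≤ k) :
    (parityHaar d k).real {x | x.1 1 = 1} = 1 / 2 := by
  have : NeZero k := ⟨by omega⟩
  have : Fact (1 < k) := ⟨by omega⟩
  let π : FreeProd d k →* Multiplicative (ZMod k) := Monoid.CoprodI.lift fun _ => MonoidHom.id _
  let f : ZMod k → ZMod 2 := fun a => if a = 0 ∨ a = 1 then 1 else 0
  have hf : ∑ a, f a = 0 := by
    have h1 : (Finset.univ.filter fun a : ZMod k => a = 0 ∨ a = 1) = {0, 1} := by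
      ext a
      simp
    simp only [f, ← Finset.sum_filter, h1]
    rw [Finset.sum_pair zero_ne_one]
    decide
  have hx : (fun g => f (Multiplicative.toAdd (π g))) ∈ parityCheck d k := by
    intro g i
    have h1 : ∀ j : ℕ, Multiplicative.toAdd (π (g * gen k i ^ j)) =
        Multiplicative.toAdd (π g) + j := fun j => by
      rw [gen_pow, map_mul, Monoid.CoprodI.lift_of]
      rfl
    simp only [h1]
    rw [← hf, ← Equiv.sum_comp (Equiv.addLeft (Multiplicative.toAdd (π g))),
      ← Fin.sum_univ_eq_sum_range fun j : ℕ => f (Multiplicative.toAdd (π g) + (j : ZMod k))]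
    refine Fintype.sum_bijective (fun j : Fin k => ((j : ℕ) : ZMod k)) ?_ _ _ fun j => rfl
    rw [Fintype.bijective_iff_injective_and_card]
    refine ⟨fun a b h => ?_, by simp [ZMod.card]⟩
    have h3 := (ZMod.natCast_eq_natCast_iff' _ _ _).1 h
    rw [Nat.mod_eq_of_lt a.2, Nat.mod_eq_of_lt b.2] at h3
    exact Fin.ext h3
  let x₀ : parityCheck d k := ⟨_, hx⟩
  have hx₀ : x₀.1 1 = 1 := by simp [x₀, f]
  set A : Set (parityCheck d k) := {x | x.1 1 = 1} with hA
  have hAm : MeasurableSet A := measurableSet_apply_eq_one 1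
  have h1 : (fun x => x₀ + x) ⁻¹' A = Aᶜ := by
    ext x
    change x₀.1 1 + x.1 1 = 1 ↔ ¬ x.1 1 = 1
    rw [hx₀]
    generalize x.1 1 = y
    revert y
    decide
  have h2 := (measurePreserving_add_left (parityHaar d k) x₀).measureReal_preimage
    hAm.nullMeasurableSet
  rw [h1, measureReal_compl hAm, probReal_univ] at h2
  linarith

theorem even_card_of_mem_parityCheck {x : FreeProd d k → ZMod 2} (hx : x ∈ parityCheck d k)
    (i : Fin d) : Even (Finset.univ.filter fun a : Fin k => x (gen k i ^ (a : ℕ)) = 1).card := by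
  have h := hx 1 i
  rw [← ZMod.natCast_eq_zero_iff_even, ← h, Finset.card_filter, Nat.cast_sum,
    ← Fin.sum_univ_eq_sum_range fun j : ℕ => x (1 * gen k i ^ j)]
  refine Finset.sum_congr rfl fun a _ => ?_
  rw [one_mul]
  generalize x (gen k i ^ (a : ℕ)) = y
  revert y
  decide

theorem two_mul_card_filter_of_even {n k : ℕ} (hn : Even n) (hk : n ≤ k) :
    2 * (Finset.univ.filter fun m : Fin k => 2 * ((m : ℕ) + 1) ≤ n).card = n := by
  obtain ⟨r, rfl⟩ := hn
  have h : (Finset.univ.filter fun m : Fin k => 2 * ((m : ℕ) + 1) ≤ r + r) =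
      Finset.univ.filter fun m : Fin k => (m : ℕ) < r := by
    refine Finset.filter_congr fun m _ => ?_
    omega
  rw [h, Fin.card_filter_val_lt]
  omega

open Classical in
/-- An action that weakly contains the parity check system has a set of measure close to `1/2` such
that all points outside a set of small measure lie in an even number of its translates by the
powers of `sᵢ`. -/
theorem WeaklyContained.exists_even_set (hk : 2 ≤ k) {Y : Type*} [MeasurableSpace Y]
    {ν : Measure Y} [IsProbabilityMeasure ν] {b : PMPAction (FreeProd d k) Y ν}
    (h : WeaklyContained (paritySystem d k) b) {ε : ℝ} (hε : 0 < ε) :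
    ∃ B : Set Y, MeasurableSet B ∧ |ν.real B - 1 / 2| ≤ ε ∧ ∀ i : Fin d,
      ν.real {y | Odd (Finset.univ.filter fun a : Fin k =>
        y ∈ b.act (gen k i ^ (a : ℕ)) '' B).card} ≤ ε := by
  let N : Fin d → parityCheck d k → ℕ := fun i x =>
    (Finset.univ.filter fun a : Fin k => x.1 (gen k i ^ (a : ℕ)) = 1).card
  have hN : ∀ i, Measurable (N i) := fun i => by
    simp only [N, Finset.card_filter]
    exact Finset.measurable_sum _ fun a _ => Measurable.ite (measurableSet_apply_eq_one _)
      measurable_const measurable_const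
  -- `none` indexes the event that the coordinate at the identity is `1`, and `some (i, m)` the
  -- event that at least `2 (m + 1)` of the coordinates at powers of `sᵢ` are `1`.
  let A : Option (Fin d × Fin k) → Set (parityCheck d k) := fun o =>
    o.elim {x | x.1 1 = 1} fun p => {x | 2 * ((p.2 : ℕ) + 1) ≤ N p.1 x}
  have hA : ∀ o, MeasurableSet (A o)
    | none => measurableSet_apply_eq_one 1
    | some p => hN p.1 (measurableSet_Ici (a := 2 * ((p.2 : ℕ) + 1)))
  -- The square of the sum `k + 2k` of the absolute values of the coefficients below, plus `1` to
  -- make it at least `1`.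
  set C : ℝ := (3 * k) ^ 2 + 1 with hC
  have hC1 : 1 ≤ C := by nlinarith
  have hC0 : 0 < C := zero_lt_one.trans_le hC1
  obtain ⟨B, hB, hAB⟩ := h.exists_translates hA
    (insert 1 (Finset.univ.image fun p : Fin d × Fin k => gen k p.1 ^ (p.2 : ℕ)))
    (div_pos hε hC0)
  refine ⟨B none, hB none, ?_, fun i => ?_⟩
  · have h1 := hAB 1 (Finset.mem_insert_self _ _) 1 (Finset.mem_insert_self _ _) none none
    rw [PMPAction.image_one, PMPAction.image_one, Set.inter_self, Set.inter_self,
      show (parityHaar d k).real (A none) = 1 / 2 from parityHaar_real_half hk, abs_sub_comm] at h1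
    exact h1.le.trans (div_le_self hε.le hC1)
  -- The combination `∑ₐ 1[sᵢ^a A] - 2 ∑ₘ 1[N ≥ 2 (m + 1)]` is zero on `X`.
  · let γ : Fin k ⊕ Fin k → FreeProd d k := Sum.elim (fun a => gen k i ^ (a : ℕ)) fun _ => 1
    let o : Fin k ⊕ Fin k → Option (Fin d × Fin k) :=
      Sum.elim (fun _ => none) fun m => some (i, m)
    let c : Fin k ⊕ Fin k → ℝ := Sum.elim (fun _ => 1) fun _ => -2
    have hγ : ∀ l, γ l ∈ insert 1
        (Finset.univ.image fun p : Fin d × Fin k => gen k p.1 ^ (p.2 : ℕ)) := by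
      rintro (a | m)
      · exact Finset.mem_insert_of_mem (Finset.mem_image.2 ⟨(i, a), Finset.mem_univ _, rfl⟩)
      · exact Finset.mem_insert_self _ _
    have key := integral_sq_sum_indicator_le
      (fun l => (paritySystem d k).measurableSet_image (γ l) (hA (o l)))
      (fun l => b.measurableSet_image (γ l) (hB (o l))) c
      fun l m => (hAB _ (hγ l) _ (hγ m) (o l) (o m)).le
    have hX : ∀ x, ∑ l, c l * ((paritySystem d k).act (γ l) '' A (o l)).indicator 1 x = 0 := by
      intro x
      have e1 : ∀ a : Fin k, x ∈ (paritySystem d k).act (gen k i ^ (a : ℕ)) '' A none ↔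
          x.1 (gen k i ^ (a : ℕ)) = 1 := fun a => by
        rw [PMPAction.image_eq_preimage]
        change x.1 ((gen k i ^ (a : ℕ))⁻¹⁻¹ * 1) = 1 ↔ _
        rw [inv_inv, mul_one]
      have e2 : ∀ m : Fin k, x ∈ A (some (i, m)) ↔ 2 * ((m : ℕ) + 1) ≤ N i x := fun m => Iff.rfl
      simp only [Fintype.sum_sum_type, c, γ, o, Sum.elim_inl, Sum.elim_inr, PMPAction.image_one,
        Set.indicator_apply, e1, e2, Pi.one_apply, one_mul, ← Finset.mul_sum, Finset.sum_boole]
      have h1 := two_mul_card_filter_of_even (k := k) (even_card_of_mem_parityCheck x.2 i)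
        ((Finset.card_le_univ _).trans (Fintype.card_fin k).le)
      have h2 : (2 : ℝ) * (Finset.univ.filter fun m : Fin k => 2 * ((m : ℕ) + 1) ≤ N i x).card =
        (N i x : ℕ) := by exact_mod_cast h1
      change ((N i x : ℕ) : ℝ) + _ = 0
      linarith
    have hc : (∑ l, |c l|) ^ 2 * (ε / C) ≤ ε := by
      have : ∑ l, |c l| = 3 * k := by
        simp only [Fintype.sum_sum_type, c, Sum.elim_inl, Sum.elim_inr, abs_one, abs_neg,
          Finset.sum_const, Finset.card_univ, Fintype.card_fin, nsmul_eq_mul]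
        norm_num
        ring
      rw [this, ← mul_div_assoc, div_le_iff₀ hC0, hC]
      nlinarith
    simp only [hX, ne_eq, OfNat.ofNat_ne_zero, not_false_eq_true, zero_pow, integral_zero,
      zero_add] at key
    refine le_trans ?_ (key.trans hc)
    have hOm : MeasurableSet {y | Odd (Finset.univ.filter fun a : Fin k =>
        y ∈ b.act (gen k i ^ (a : ℕ)) '' B none).card} := by
      have : Measurable fun y => (Finset.univ.filter fun a : Fin k =>
          y ∈ b.act (gen k i ^ (a : ℕ)) '' B none).card := by
        simp only [Finset.card_filter]
        exact Finset.measurable_sum _ fun a _ => Measurable.ite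
          (b.measurableSet_image _ (hB none)) measurable_const measurable_const
      exact this (MeasurableSet.of_discrete (s := {n : ℕ | Odd n}))
    rw [← integral_indicator_one hOm]
    refine integral_mono ((integrable_const (1 : ℝ)).indicator hOm) ?_ fun y => ?_
    · have hm : Measurable fun y => ∑ l, c l * (b.act (γ l) '' B (o l)).indicator (1 : Y → ℝ) y :=
        Finset.measurable_sum _ fun l _ => (measurable_one.indicator
          (b.measurableSet_image _ (hB _))).const_mul _
      refine Integrable.of_bound (hm.pow_const 2).aestronglyMeasurable ((∑ l, |c l|) ^ 2)
        (ae_of_all _ fun y => ?_)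
      rw [norm_pow]
      refine pow_le_pow_left₀ (norm_nonneg _) ((norm_sum_le _ _).trans
        (Finset.sum_le_sum fun l _ => ?_)) 2
      rw [norm_mul, Real.norm_eq_abs]
      refine mul_le_of_le_one_right (abs_nonneg _) ?_
      rw [Set.indicator_apply]
      split_ifs <;> simp
    · simp only
      by_cases hy : Odd (Finset.univ.filter fun a : Fin k =>
        y ∈ b.act (gen k i ^ (a : ℕ)) '' B none).card
      · rw [Set.indicator_of_mem (by exact hy)]
        have e1 : ∑ l, c l * (b.act (γ l) '' B (o l)).indicator (1 : Y → ℝ) y =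
            (((Finset.univ.filter fun a : Fin k =>
              y ∈ b.act (gen k i ^ (a : ℕ)) '' B none).card : ℤ) +
            -2 * (Finset.univ.filter fun m : Fin k =>
              y ∈ b.act 1 '' B (some (i, m))).card : ℤ) := by
          rw [Fintype.sum_sum_type]
          simp only [c, Sum.elim_inl, Sum.elim_inr, one_mul, ← Finset.mul_sum]
          rw [sum_indicator_one_apply, sum_indicator_one_apply]
          push_cast
          rfl
        -- An odd number minus an even number is a nonzero integer, so its square is at least `1`.
        rw [e1, Pi.one_apply]
        obtain ⟨r, hr⟩ := hy
        rw [hr]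
        have h3 : ∀ z : ℤ, z ≠ 0 → (1 : ℝ) ≤ (z : ℝ) ^ 2 := fun z hz => by
          have : 1 ≤ z ^ 2 := by
            have := sq_pos_of_ne_zero hz
            omega
          exact_mod_cast this
        refine h3 _ ?_
        push_cast
        omega
      · rw [Set.indicator_of_notMem (by exact hy)]
        positivity

end ParitySystem

/-! ### Assembling the contradiction -/

section Conclusion

theorem bernoulliShift_mem_image {Γ : Type*} [Group Γ] {K : Type*} [MeasurableSpace K]
    {κ : Measure K} [IsProbabilityMeasure κ] (γ : Γ) (B : Set (Γ → K)) (ω : Γ → K) :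
    ω ∈ (bernoulliShift Γ K κ).act γ '' B ↔ ω ∘ Equiv.mulLeft γ ∈ B := by
  rw [PMPAction.image_eq_preimage]
  have : (bernoulliShift Γ K κ).act γ⁻¹ ω = ω ∘ Equiv.mulLeft γ := by
    funext h
    simp [bernoulliShift, shift]
  rw [Set.mem_preimage, this]

variable {d k : ℕ}

theorem cosetPattern_subset_of_symmDiff {K : Type*} (B B' : Set (FreeProd d k → K)) (i : Fin d) :
    {ω | Odd (cosetPattern B' i ω).card} ⊆ {ω | Odd (cosetPattern B i ω).card} ∪
      ⋃ a : Fin k, (fun ω => ω ∘ Equiv.mulLeft (gen k i ^ (a : ℕ))) ⁻¹' symmDiff B B' := by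
  intro ω hω
  by_cases h : ∃ a : Fin k, ω ∘ Equiv.mulLeft (gen k i ^ (a : ℕ)) ∈ symmDiff B B'
  · exact Or.inr (Set.mem_iUnion.2 h)
  · push Not at h
    left
    have : cosetPattern B i ω = cosetPattern B' i ω := by
      ext a
      have := h a
      rw [Set.mem_symmDiff] at this
      rw [mem_cosetPattern, mem_cosetPattern]
      tauto
    change Odd (cosetPattern B i ω).card
    rw [this]
    exact hω

theorem measureReal_odd_cosetPattern_le {K : Type*} [MeasurableSpace K] (κ : Measure K)
    [IsProbabilityMeasure κ] {B B' : Set (FreeProd d k → K)} (hB : MeasurableSet B)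
    (hB' : MeasurableSet B') (i : Fin d) :
    (Measure.infinitePi fun _ : FreeProd d k => κ).real {ω | Odd (cosetPattern B' i ω).card} ≤
      (Measure.infinitePi fun _ : FreeProd d k => κ).real {ω | Odd (cosetPattern B i ω).card} +
        k * (Measure.infinitePi fun _ : FreeProd d k => κ).real (symmDiff B B') := by
  refine (measureReal_mono (cosetPattern_subset_of_symmDiff B B' i)).trans
    ((measureReal_union_le _ _).trans (add_le_add le_rfl
      ((measureReal_iUnion_fintype_le _).trans (le_of_eq ?_))))
  have h : ∀ γ : FreeProd d k, (fun ω : FreeProd d k → K => ω ∘ Equiv.mulLeft γ) =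
      (bernoulliShift (FreeProd d k) K κ).act γ⁻¹ := fun γ => by
    funext ω g
    simp [bernoulliShift, shift]
  simp only [h, ((bernoulliShift (FreeProd d k) K κ).measurePreserving _).measureReal_preimage
    (hB.symmDiff hB').nullMeasurableSet]
  simp

theorem theoremC (d k : ℕ) (hd : 3 ≤ d) (hk : d < k)
    (K : Type*) [MeasurableSpace K] [StandardBorelSpace K]
    (κ : Measure K) [IsProbabilityMeasure κ] :
    ¬ WeaklyContained (paritySystem d k) (bernoulliShift (FreeProd d k) K κ) := by
  classical
  intro h
  set μ := Measure.infinitePi fun _ : FreeProd d k => κ with hμ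
  have hk0 : (0 : ℝ) < k := by exact_mod_cast (by omega : 0 < k)
  have hd0 : (0 : ℝ) < d := by exact_mod_cast (by omega : 0 < d)
  set δ : ℝ := (1 / 2 : ℝ) ^ (4 * d * k) with hδ
  have hδ0 : 0 < δ := by positivity
  have hδ1 : δ ≤ 1 / 4 := by
    have := pow_le_pow_of_le_one (a := (1 / 2 : ℝ)) (by norm_num) (by norm_num)
      (show 2 ≤ 4 * d * k by nlinarith)
    norm_num at this ⊢
    linarith
  -- The error is small enough to keep the measure of the approximating set within `1/4` of `1/2`,
  -- and the probability `(k + 1) η` of an odd pattern at most `k δ / (8 d)`.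
  set η : ℝ := min (1 / 8) (δ / (16 * d)) with hη
  have hη0 : 0 < η := by positivity
  obtain ⟨B, hB, hBhalf, hBodd⟩ := h.exists_even_set (by omega) hη0
  obtain ⟨B', ⟨Q, hQ, π, D, Y, hπ, hY, rfl⟩, hBm', hBB'⟩ :=
    exists_finiteWindowSet_measureReal_symmDiff_lt μ hB hη0
  have := Fintype.ofFinite Q
  let _ : MeasurableSpace Q := ⊤
  have hπm : Measurable π := measurable_to_countable' hπ
  let E : Finset (FreeProd d k) := Finset.univ.biUnion fun p : Fin d × Fin k =>
    D.image fun u => gen k p.1 ^ (p.2 : ℕ) * u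
  have hE : ∀ i, ∀ a : Fin k, ∀ u ∈ D, gen k i ^ (a : ℕ) * u ∈ E := fun i a u hu =>
    Finset.mem_biUnion.2 ⟨(i, a), Finset.mem_univ _, Finset.mem_image_of_mem _ hu⟩
  let w : Q → ℝ := fun q => κ.real (π ⁻¹' {q})
  have hw : w ∈ stdSimplex ℝ Q := by
    refine ⟨fun q => measureReal_nonneg, ?_⟩
    have : IsProbabilityMeasure (κ.map π) := Measure.isProbabilityMeasure_map hπm.aemeasurable
    have h1 : ∀ q, w q = (κ.map π).real {q} := fun q =>
      (map_measureReal_apply hπm (MeasurableSet.singleton q)).symm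
    simp only [h1]
    rw [sum_measureReal_singleton, Finset.coe_univ, probReal_univ]
  obtain ⟨x₀⟩ : Nonempty K := by
    by_contra hK
    rw [not_nonempty_iff] at hK
    exact IsProbabilityMeasure.ne_zero κ κ.eq_zero_of_isEmpty
  refine not_even_block_factor hd (by omega) hw hY hE (fun _ => π x₀)
    (avgs_indicator_eq_measureReal κ hπm hY _) ?_ fun i => ?_
  · have h1 := abs_le.1 hBhalf
    have h2 := abs_le.1 ((abs_measureReal_sub_le_measureReal_symmDiff
      hB.nullMeasurableSet hBm'.nullMeasurableSet).trans hBB'.le)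
    have h3 : η ≤ 1 / 8 := min_le_left _ _
    change (1 / 2 : ℝ) ^ (4 * d * k) ≤ 2 * μ.real _ * (1 - μ.real _)
    nlinarith
  · have hO : DependsOn (· ∈ {ω | Odd (cosetPattern Y i ω).card}) E := fun x y hxy => by
      change Odd (cosetPattern Y i x).card = Odd (cosetPattern Y i y).card
      rw [dependsOn_cosetPattern hY (hE i) hxy]
    rw [avgs_indicator_eq_measureReal κ hπm hO]
    have h1 := measureReal_odd_cosetPattern_le κ hB hBm' i
    have h2 := hBodd i
    simp only [bernoulliShift_mem_image] at h2
    have h3 : η ≤ δ / (16 * d) := min_le_right _ _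
    have hk1 : (1 : ℝ) ≤ k := by exact_mod_cast (by omega : 1 ≤ k)
    calc _ ≤ η + k * η := h1.trans (add_le_add h2 (mul_le_mul_of_nonneg_left hBB'.le hk0.le))
      _ ≤ 2 * k * η := by nlinarith
      _ ≤ 2 * k * (δ / (16 * d)) := by gcongr
      _ = _ := by
        rw [hδ]
        field_simp
        ring

end Conclusion
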